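/- **Setting.** Let $\mathcal K$ be a compact connected metric graph (finitely many vertices and edges, every edge $e$ being identified with an interval $[0,\ell_e]$, $0<\ell_e<\infty$; loops and multiple edges are allowed). Let $D,R$ be disjoint non-empty sets of vertices of $\mathcal K$ and $\sigma:D\to R$ a bijection. Take copies $\mathcal K_i$, $i\in\mathbb Z$, of $\mathcal K$ and, for every $i\in\mathbb Z$ and $v\in D$, identify the vertex $v$ of $\mathcal K_i$ with the vertex $\sigma(v)$ of $\mathcal K_{i+1}$. The resulting metric graph $\mathcal G$ is the periodic graph with periodicity cell $\mathcal K$ and pasting rule $\sigma$; the image of $\mathcal K_i$ in $\mathcal G$ is again denoted by $\mathcal K_i$. Let $H^1(\mathcal G)$ be the space of continuous functions $u:\mathcal G\to\mathbb R$ whose restriction to every edge is in $H^1$ and such that $u,u'\in L^2(\mathcal G)$, with norm $\|u\|_{H^1(\mathcal G)}^2=\|u\|_{L^2(\mathcal G)}^2+\|u'\|_{L^2(\mathcal G)}^2$. For $\mu>0$ and $p>2$ put $$H^1_\mu(\mathcal G)=\{u\in H^1(\mathcal G):\|u\|_{L^2(\mathcal G)}^2=\mu\},\qquad E(u,\mathcal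 G)=\frac12\int_{\mathcal G}|u'|^2\,dx-\frac1p\int_{\mathcal G}|u|^p\,dx,\qquad \mathcal E_{\mathcal G}(\mu)=\inf_{u\in H^1_\mu(\mathcal G)}E(u,\mathcal G)\in[-\infty,+\infty).$$ A ground state of mass $\mu$ is a function $u\in H^1_\mu(\mathcal G)$ with $E(u,\mathcal G)=\mathcal E_{\mathcal G}(\mu)$. **Proposition 3.1.** Let $\mathcal G$ be a periodic graph, $p\in(2,6)$, $\mu>0$, and suppose that $\mathcal E_{\mathcal G}(\mu)<0$. Let $(u_n)_{n\in\mathbb N}\subset H^1_\mu(\mathcal G)$ be a minimizing sequence, i.e. $E(u_n,\mathcal G)\to\mathcal E_{\mathcal G}(\mu)$, such that for every $n$ there is $x_n\in\mathcal K_0$ with $\|u_n\|_{L^\infty(\mathcal G)}=u_n(x_n)$. Then there exist a ground state $u\in H^1_\mu(\mathcal G)$ of mass $\mu$ and a subsequence $(u_{n_k})_k$ such that $u_{n_k}\to u$ strongly in $H^1(\mathcal G)$ as $k\to\infty$. -/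

import Mathlib

open Filter Topology MeasureTheory
open scoped ENNReal

set_option linter.checkUnivs false

universe u v

noncomputable section

/-- A connected metric graph. Every edge `e` is a bounded segment, identified with the real interval
`[0, len e]` by a coordinate running from the vertex `src e` to the vertex `tgt e`. Self-loops and
multiple edges are allowed. -/
structure MetricGraph where
  /-- the vertices -/
  V : Type u
  /-- the edges -/
  E : Type v
  /-- the vertex at the end `x = 0` of an edge -/
  src : E → V
  /-- the vertex at the end `x = len e` of an edge -/
  tgt : E → V
  /-- the length of an edge -/
  len : E → ℝ
  len_pos : ∀ e, 0 < len e
  /-- any two vertices are joined by a finite chain of edges (traversed in either direction) -/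
  connected : ∀ a b : V, Relation.EqvGen (fun a b => ∃ e, src e = a ∧ tgt e = b) a b

/-- A compact graph: finitely many vertices and edges (all edges have finite length). -/
structure CompactGraph extends MetricGraph.{u, v} where
  finite_V : Finite V
  finite_E : Finite E

namespace MetricGraph

/-- The disjoint union of the vertices and of the closed segments `[0, len e]`. -/
abbrev PrePoint (G : MetricGraph.{u, v}) : Type (max u v) :=
  G.V ⊕ ((e : G.E) × Set.Icc (0 : ℝ) (G.len e))

/-- The two ends of every segment are glued to the corresponding vertices. -/
inductive Glue (G : MetricGraph.{u, v}) : G.PrePoint → G.PrePoint → Prop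
  | src (e : G.E) : Glue G (Sum.inl (G.src e)) (Sum.inr ⟨e, ⟨0, le_rfl, (G.len_pos e).le⟩⟩)
  | tgt (e : G.E) : Glue G (Sum.inl (G.tgt e)) (Sum.inr ⟨e, ⟨G.len e, (G.len_pos e).le, le_rfl⟩⟩)

/-- The points of the metric graph. -/
def Point (G : MetricGraph.{u, v}) : Type (max u v) := Quot G.Glue

/-- The quotient topology, the set of vertices being discrete. -/
instance (G : MetricGraph.{u, v}) : TopologicalSpace G.Point :=
  letI : TopologicalSpace G.V := ⊥
  inferInstanceAs (TopologicalSpace (Quot G.Glue))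

/-- A vertex, as a point of the graph. -/
def vertex (G : MetricGraph.{u, v}) (a : G.V) : G.Point := Quot.mk _ (Sum.inl a)

/-- The point with coordinate `x ∈ [0, len e]` on the edge `e` (`x` is first projected to
`[0, len e]`, so that this makes sense for every real `x`). -/
def pt (G : MetricGraph.{u, v}) (e : G.E) (x : ℝ) : G.Point :=
  Quot.mk _ (Sum.inr ⟨e, Set.projIcc 0 (G.len e) (G.len_pos e).le x⟩)

/-- The length measure of the graph, read in the edge coordinates: the sum over the edges `e` of
the Lebesgue measure of `{e} × [0, len e]`. (The set of vertices is a null set.) -/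
def vol (G : MetricGraph.{u, v}) : Measure ((_ : G.E) × ℝ) :=
  Measure.sum fun e => (volume.restrict (Set.Icc 0 (G.len e))).map (Sigma.mk e)

/-- A function `f` on the graph read in the edge coordinates: the family `(f_e)_e`. -/
def coord (G : MetricGraph.{u, v}) (f : G.Point → ℝ) : ((_ : G.E) × ℝ) → ℝ :=
  fun q => f (G.pt q.1 q.2)

/-- The derivative `f'` of a function on the graph, read in the edge coordinates: the family
`(f_e')_e`. -/
def dcoord (G : MetricGraph.{u, v}) (f : G.Point → ℝ) : ((_ : G.E) × ℝ) → ℝ :=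
  fun q => deriv (fun x => f (G.pt q.1 x)) q.2

/-- The Sobolev space `H¹(G)`: `f` is continuous on `G`, its restriction to each edge belongs to
`H¹` (a continuous function on a bounded interval is in `H¹` iff it is absolutely continuous with
derivative in `L²`; the derivative is then the weak one), and `f`, `f'` belong to `L²(G)`. -/
def H1 (G : MetricGraph.{u, v}) : Set (G.Point → ℝ) :=
  {f | Continuous f ∧
    (∀ e, AbsolutelyContinuousOnInterval (fun x => f (G.pt e x)) 0 (G.len e)) ∧
    MemLp (G.coord f) 2 G.vol ∧ MemLp (G.dcoord f) 2 G.vol}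

/-- The norm of `H¹(G)`, `(‖f‖₂² + ‖f'‖₂²)^(1/2)`. -/
def h1Norm (G : MetricGraph.{u, v}) (f : G.Point → ℝ) : ℝ≥0∞ :=
  (eLpNorm (G.coord f) 2 G.vol ^ 2 + eLpNorm (G.dcoord f) 2 G.vol ^ 2) ^ (1 / 2 : ℝ)

/-- `H¹_μ(G)`: the functions of `H¹(G)` with mass `‖f‖₂² = μ`. -/
def H1Mass (G : MetricGraph.{u, v}) (μ : ℝ) : Set (G.Point → ℝ) :=
  {f | f ∈ G.H1 ∧ ∫ q, G.coord f q ^ 2 ∂G.vol = μ}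

/-- The energy `E(f, G) = (1/2) ∫_G |f'|² - (1/p) ∫_G |f|ᵖ`. -/
def energy (G : MetricGraph.{u, v}) (p : ℝ) (f : G.Point → ℝ) : ℝ :=
  (1 / 2) * ∫ q, |G.dcoord f q| ^ 2 ∂G.vol - (1 / p) * ∫ q, |G.coord f q| ^ p ∂G.vol

/-- The ground state energy level: the infimum of the energy over `H¹_μ(G)`, in `[-∞, ∞]`. -/
def level (G : MetricGraph.{u, v}) (p μ : ℝ) : EReal :=
  ⨅ f ∈ G.H1Mass μ, (G.energy p f : EReal)

/-- A ground state of mass `μ`: a global minimizer of the energy over `H¹_μ(G)`. -/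
def IsGroundState (G : MetricGraph.{u, v}) (p μ : ℝ) (f : G.Point → ℝ) : Prop :=
  f ∈ G.H1Mass μ ∧ (G.energy p f : EReal) = G.level p μ

/-- A minimizing sequence of the energy in `H¹_μ(G)`. -/
def IsMinimizingSeq (G : MetricGraph.{u, v}) (p μ : ℝ) (f : ℕ → G.Point → ℝ) : Prop :=
  (∀ n, f n ∈ G.H1Mass μ) ∧
    Tendsto (fun n => (G.energy p (f n) : EReal)) atTop (𝓝 (G.level p μ))

end MetricGraph

/-- A pasting rule on a compact graph `K`: two disjoint non-empty sets of vertices, the donors `D`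
and the receivers `R`, and a bijection `σ : D → R`. -/
structure PastingRule (K : CompactGraph.{u, v}) where
  /-- the donors -/
  D : Set K.V
  /-- the receivers -/
  R : Set K.V
  /-- the pasting map -/
  σ : D → R
  nonempty_D : D.Nonempty
  nonempty_R : R.Nonempty
  disjoint : D ∩ R = ∅
  bijective : Function.Bijective σ

namespace PastingRule

variable {K : CompactGraph.{u, v}}

/-- The relation that identifies, for every `i`, each donor `d` of the `i`-th copy of `K` with the
receiver `σ d` of the `(i+1)`-th copy; the pair `(i, a)` is the vertex `a` of the `i`-th copy. -/
def Rel (P : PastingRule K) (x y : ℤ × K.V) : Prop :=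
  x = y ∨
  (∃ (i : ℤ) (d : P.D), x = (i, d.1) ∧ y = (i + 1, (P.σ d).1)) ∨
  (∃ (i : ℤ) (d : P.D), y = (i, d.1) ∧ x = (i + 1, (P.σ d).1))

theorem not_mem_both (P : PastingRule K) {a : K.V} (h : a ∈ P.D) (h' : a ∈ P.R) : False := by
  have : a ∈ P.D ∩ P.R := ⟨h, h'⟩
  rw [P.disjoint] at this
  exact this

theorem rel_equivalence (P : PastingRule K) : Equivalence P.Rel where
  refl _ := Or.inl rfl
  symm h := by
    rcases h with h | h | h
    · exact Or.inl h.symm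
    · exact Or.inr (Or.inr h)
    · exact Or.inr (Or.inl h)
  trans := by
    intro x y z h1 h2
    rcases h1 with rfl | ⟨i, d, h1, h1'⟩ | ⟨i, d, h1, h1'⟩
    · exact h2
    · rcases h2 with rfl | ⟨j, d', h2, h2'⟩ | ⟨j, d', h2, h2'⟩
      · exact Or.inr (Or.inl ⟨i, d, h1, h1'⟩)
      · exfalso
        have e := congrArg Prod.snd (h1'.symm.trans h2)
        exact P.not_mem_both d'.2 (by rw [← show (P.σ d).1 = d'.1 from e]; exact (P.σ d).2)
      · left
        have e := h1'.symm.trans h2'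
        have e1 : i + 1 = j + 1 := congrArg Prod.fst e
        have e2 : d = d' := P.bijective.1 (Subtype.ext (congrArg Prod.snd e))
        have e3 : i = j := by omega
        subst e2 e3
        exact h1.trans h2.symm
    · rcases h2 with rfl | ⟨j, d', h2, h2'⟩ | ⟨j, d', h2, h2'⟩
      · exact Or.inr (Or.inr ⟨i, d, h1, h1'⟩)
      · left
        have e := h1.symm.trans h2
        have e1 : i = j := congrArg Prod.fst e
        have e2 : d = d' := Subtype.ext (congrArg Prod.snd e)
        subst e1 e2
        exact h1'.trans h2'.symm
      · exfalso
        have e := congrArg Prod.snd (h1.symm.trans h2')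
        exact P.not_mem_both d.2 (by rw [show d.1 = (P.σ d').1 from e]; exact (P.σ d').2)

/-- The pasting relation as an equivalence relation on the vertices of all the copies of `K`. -/
def setoid (P : PastingRule K) : Setoid (ℤ × K.V) := ⟨P.Rel, P.rel_equivalence⟩

/-- The adjacency of vertices (along oriented edges) in the periodic graph. -/
def Adj (P : PastingRule K) (a b : Quotient P.setoid) : Prop :=
  ∃ e : ℤ × K.E, (Quotient.mk P.setoid (e.1, K.src e.2)) = a ∧
    (Quotient.mk P.setoid (e.1, K.tgt e.2)) = b

theorem connected_copy (P : PastingRule K) (i : ℤ) {a b : K.V}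
    (h : Relation.EqvGen (fun a b => ∃ e, K.src e = a ∧ K.tgt e = b) a b) :
    Relation.EqvGen P.Adj (Quotient.mk P.setoid (i, a)) (Quotient.mk P.setoid (i, b)) := by
  induction h with
  | rel x y h =>
    obtain ⟨e, rfl, rfl⟩ := h
    exact .rel _ _ ⟨(i, e), rfl, rfl⟩
  | refl x => exact .refl _
  | symm x y _ ih => exact .symm _ _ ih
  | trans x y z _ _ ih1 ih2 => exact .trans _ _ _ ih1 ih2

theorem connected (P : PastingRule K) (a b : Quotient P.setoid) : Relation.EqvGen P.Adj a b := by
  obtain ⟨d, hd⟩ := P.nonempty_D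
  have step : ∀ i : ℤ, Relation.EqvGen P.Adj (Quotient.mk P.setoid (i, d))
      (Quotient.mk P.setoid (i + 1, d)) := by
    intro i
    have h : (Quotient.mk P.setoid (i, d)) = Quotient.mk P.setoid (i + 1, (P.σ ⟨d, hd⟩).1) :=
      Quotient.sound (Or.inr (Or.inl ⟨i, ⟨d, hd⟩, rfl, rfl⟩))
    rw [h]
    exact P.connected_copy (i + 1) (K.connected _ _)
  have all : ∀ i : ℤ, Relation.EqvGen P.Adj (Quotient.mk P.setoid (0, d))
      (Quotient.mk P.setoid (i, d)) := by
    intro i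
    induction i using Int.induction_on with
    | zero => exact .refl _
    | succ i ih => exact .trans _ _ _ ih (step i)
    | pred i ih =>
      refine .trans _ _ _ ih (.symm _ _ ?_)
      have := step (-(i : ℤ) - 1)
      rwa [sub_add_cancel] at this
  have base : ∀ a : Quotient P.setoid, Relation.EqvGen P.Adj (Quotient.mk P.setoid (0, d)) a := by
    intro a
    induction a using Quotient.inductionOn with
    | h x => exact .trans _ _ _ (all x.1) (P.connected_copy x.1 (K.connected d x.2))
  exact .trans _ _ _ (.symm _ _ (base a)) (base b)

/-- The periodic graph with periodicity cell `K` and pasting rule `P`: its vertices are the vertices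
of the copies of `K`, indexed by `ℤ`, modulo the pasting relation; its edges are the edges of all the
copies of `K`. -/
def graph (P : PastingRule K) : MetricGraph.{u, v} where
  V := Quotient P.setoid
  E := ℤ × K.E
  src e := Quotient.mk P.setoid (e.1, K.src e.2)
  tgt e := Quotient.mk P.setoid (e.1, K.tgt e.2)
  len e := K.len e.2
  len_pos e := K.len_pos e.2
  connected := P.connected

/-- The `i`-th copy of the periodicity cell, as a set of points of the periodic graph. -/
def cell (P : PastingRule K) (i : ℤ) : Set P.graph.Point :=
  {q | (∃ a : K.V, q = P.graph.vertex (Quotient.mk P.setoid (i, a))) ∨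
    ∃ (e : K.E) (x : ℝ), q = P.graph.pt (i, e) x}

end PastingRule

end

/-! The argument is concentration-compactness without translations, since the maxima are already
pinned to one cell. Because `p < 6`, energy sublevels at fixed mass are bounded in H¹ and in L^∞
(`exists_bound_of_energy_le`), so a subsequence converges pointwise, with weakly convergent
derivatives, to some g in H¹ (`exists_subseq_tendsto_of_bounded`). The Hilbert identity for
derivatives and the Brezis–Lieb lemma (`tendsto_integral_brezisLieb`) for r = 2 and r = p show that
mass and energy split asymptotically between g and f_n - g.

Let m be the mass of g and L the level. If m = 0, then f_n → 0 uniformly on the finitely many edges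
of the cell, hence in L^∞, since the maximum is attained there. The potential energy then vanishes
in the limit, which contradicts L < 0. If 0 < m < μ, rescaling g to mass μ gives E(g) > (m/μ)L
(`lt_energy_of_mass_lt`), and likewise E(f_n - g) ≥ (mass/μ)L; adding these gives L > L in the
limit. So m = μ. Then f_n - g → 0 in L², and by the L^∞ bound in L^p, so half the squared norm of
f_n' - g' tends to L - E(g) ≤ 0. Hence E(g) = L and convergence is strong.

The periodic structure supplies only a positive lower bound on edge lengths, countably many edges,
the finiteness of each cell and the absence of isolated vertices. -/

/-! ### Weak sequential compactness in Hilbert space -/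

/-- The closed span S of the sequence is separable, so sequential Banach–Alaoglu and the Riesz
representation apply in S. A general y is handled through its orthogonal projection onto S, which
has the same inner products with elements of S. -/
theorem exists_subseq_tendsto_inner_of_bounded {H : Type*} [NormedAddCommGroup H]
    [InnerProductSpace ℝ H] [CompleteSpace H] (x : ℕ → H) {C : ℝ} (hx : ∀ n, ‖x n‖ ≤ C) :
    ∃ (h : H) (φ : ℕ → ℕ), StrictMono φ ∧
      ∀ y : H, Tendsto (fun n => inner ℝ (x (φ n)) y) atTop (𝓝 (inner ℝ h y)) := by
  set S : Submodule ℝ H := (Submodule.span ℝ (Set.range x)).topologicalClosure with hS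
  have hxS : ∀ n, x n ∈ S := fun n =>
    Submodule.le_topologicalClosure _ (Submodule.subset_span ⟨n, rfl⟩)
  have hclosed : IsClosed (S : Set H) := Submodule.isClosed_topologicalClosure _
  have : CompleteSpace S := hclosed.completeSpace_coe
  have hsep : TopologicalSpace.IsSeparable (S : Set H) := by
    rw [hS, Submodule.topologicalClosure_coe]
    exact ((Set.countable_range x).isSeparable.span (R := ℝ)).closure
  have : TopologicalSpace.SeparableSpace S := hsep.separableSpace
  let T : ℕ → WeakDual ℝ S := fun n =>
    StrongDual.toWeakDual (InnerProductSpace.toDual ℝ S ⟨x n, hxS n⟩)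
  have hT : ∀ n, T n ∈ WeakDual.toStrongDual ⁻¹' Metric.closedBall (0 : StrongDual ℝ S) C := by
    intro n
    have h1 := ((InnerProductSpace.toDual ℝ S).norm_map ⟨x n, hxS n⟩).trans_le (hx n)
    rw [Set.mem_preimage, Metric.mem_closedBall]
    exact (dist_zero_right (InnerProductSpace.toDual ℝ S ⟨x n, hxS n⟩)).trans_le h1
  obtain ⟨t, -, φ, hφ, ht⟩ := WeakDual.isSeqCompact_closedBall ℝ S 0 C hT
  set h : S := (InnerProductSpace.toDual ℝ S).symm (WeakDual.toStrongDual t) with hh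
  refine ⟨h, φ, hφ, fun y => ?_⟩
  have h1 := (WeakDual.eval_continuous (𝕜 := ℝ) (S.orthogonalProjectionOnto y)).tendsto t |>.comp ht
  have key : ∀ z : S, inner ℝ (z : H) y = inner ℝ z (S.orthogonalProjectionOnto y) := by
    intro z
    rw [← sub_eq_zero, Submodule.coe_inner, ← inner_sub_right]
    exact Submodule.inner_right_of_mem_orthogonal z.2
      (Submodule.sub_starProjection_mem_orthogonal y)
  rw [key h]
  have e1 : t (S.orthogonalProjectionOnto y) = inner ℝ h (S.orthogonalProjectionOnto y) := by
    rw [hh, InnerProductSpace.toDual_symm_apply]; rfl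
  rw [← e1]
  refine h1.congr fun n => ?_
  have := key ⟨x (φ n), hxS (φ n)⟩
  simp only [] at this
  rw [this]
  rfl

/-! ### The Brezis–Lieb lemma -/

/-- Convexity of the power applied to x + y = l(x/l) + (1-l)(y/(1-l)). The weight l is chosen so
that l^(1-r) = 1 + ε. -/
theorem add_rpow_le_one_add_mul {r : ℝ} (hr : 1 < r) {ε : ℝ} (hε : 0 < ε) :
    ∃ C : ℝ, 0 ≤ C ∧ ∀ x y : ℝ, 0 ≤ x → 0 ≤ y →
      (x + y) ^ r ≤ (1 + ε) * x ^ r + C * y ^ r := by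
  set l : ℝ := (1 + ε) ^ (-(r - 1)⁻¹) with hl
  have h1ε : (1 : ℝ) < 1 + ε := by linarith
  have hr1 : 0 < r - 1 := by linarith
  have hl0 : 0 < l := Real.rpow_pos_of_pos (by linarith) _
  have hl1 : l < 1 := Real.rpow_lt_one_of_one_lt_of_neg h1ε (by simpa using hr1)
  have hlr : l ^ (1 - r) = 1 + ε := by
    rw [hl, ← Real.rpow_mul (by linarith)]
    have : -(r - 1)⁻¹ * (1 - r) = 1 := by field_simp; ring
    rw [this, Real.rpow_one]
  have hscale : ∀ s z : ℝ, 0 < s → 0 ≤ z → s * (z / s) ^ r = s ^ (1 - r) * z ^ r := by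
    intro s z hs hz
    rw [Real.div_rpow hz hs.le, Real.rpow_sub hs, Real.rpow_one]
    field_simp
  refine ⟨(1 - l) ^ (1 - r), Real.rpow_nonneg (by linarith) _, fun x y hx hy => ?_⟩
  have h1l : 0 < 1 - l := by linarith
  have hc := (convexOn_rpow hr.le).2 (x := x / l) (y := y / (1 - l))
    (Set.mem_Ici.2 (by positivity)) (Set.mem_Ici.2 (by positivity)) hl0.le h1l.le (by ring)
  simp only [smul_eq_mul] at hc
  rw [hscale l x hl0 hx, hscale (1 - l) y h1l hy, hlr] at hc
  have e : l * (x / l) + (1 - l) * (y / (1 - l)) = x + y := by field_simp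
  rwa [e] at hc

theorem abs_rpow_add_sub_le {r : ℝ} (hr : 1 < r) {ε : ℝ} (hε : 0 < ε) :
    ∃ C : ℝ, 0 ≤ C ∧ ∀ a b : ℝ,
      |(|a + b| ^ r - |a| ^ r - |b| ^ r)| ≤ ε * |a| ^ r + C * |b| ^ r := by
  obtain ⟨C, hC, h⟩ := add_rpow_le_one_add_mul hr hε
  have habs : ∀ a b : ℝ, |a + b| ^ r ≤ (1 + ε) * |a| ^ r + C * |b| ^ r := fun a b =>
    (Real.rpow_le_rpow (abs_nonneg _) (abs_add_le a b) (by linarith)).trans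
      (h _ _ (abs_nonneg _) (abs_nonneg _))
  refine ⟨C + 1, by linarith, fun a b => ?_⟩
  have h1 := habs a b
  -- The lower bound comes from the upper one with the roles of a and a + b exchanged, because
  -- 1/(1+ε) ≥ 1 - ε.
  have h2 := habs (a + b) (-b)
  rw [add_neg_cancel_right, abs_neg] at h2
  have hA : 0 ≤ |a + b| ^ r := by positivity
  have ha : 0 ≤ |a| ^ r := by positivity
  have hb : 0 ≤ |b| ^ r := by positivity
  have hCb : 0 ≤ C * |b| ^ r := by positivity
  have h3 : (1 - ε) * |a| ^ r - C * |b| ^ r ≤ |a + b| ^ r := by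
    by_contra! hlt
    nlinarith [mul_nonneg (mul_nonneg hε.le hε.le) ha, mul_nonneg hε.le hCb]
  rw [abs_le]
  constructor <;> nlinarith

section BrezisLieb

variable {α : Type*} [MeasurableSpace α] {ν : Measure α}

theorem integrable_abs_rpow_sub {r : ℝ} (hr : 1 < r) {F g : α → ℝ}
    (hFm : AEStronglyMeasurable F ν) (hgm : AEStronglyMeasurable g ν)
    (hF : Integrable (fun x => |F x| ^ r) ν) (hg : Integrable (fun x => |g x| ^ r) ν) :
    Integrable (fun x => |F x - g x| ^ r) ν := by
  obtain ⟨C, hC, h⟩ := add_rpow_le_one_add_mul hr one_pos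
  refine Integrable.mono' ((hF.const_mul (1 + 1)).add (hg.const_mul C)) ?_ ?_
  · exact ((hFm.sub hgm).aemeasurable.abs.pow_const r).aestronglyMeasurable
  · refine ae_of_all _ fun x => ?_
    rw [Real.norm_of_nonneg (by positivity)]
    exact (Real.rpow_le_rpow (abs_nonneg _) (abs_sub (F x) (g x)) (by linarith)).trans
      (h _ _ (abs_nonneg _) (abs_nonneg _))

theorem tendsto_integral_brezisLieb {r : ℝ} (hr : 1 < r) {F : ℕ → α → ℝ} {g : α → ℝ}
    (hFm : ∀ n, AEStronglyMeasurable (F n) ν) (hgm : AEStronglyMeasurable g ν)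
    (hF : ∀ n, Integrable (fun x => |F n x| ^ r) ν) (hg : Integrable (fun x => |g x| ^ r) ν)
    {B : ℝ} (hB : ∀ n, ∫ x, |F n x| ^ r ∂ν ≤ B)
    (hlim : ∀ᵐ x ∂ν, Tendsto (fun n => F n x) atTop (𝓝 (g x))) :
    Tendsto (fun n => ∫ x, |F n x| ^ r ∂ν - ∫ x, |F n x - g x| ^ r ∂ν - ∫ x, |g x| ^ r ∂ν)
      atTop (𝓝 0) := by
  have hd : ∀ n, Integrable (fun x => |F n x - g x| ^ r) ν := fun n =>
    integrable_abs_rpow_sub hr (hFm n) hgm (hF n) hg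
  obtain ⟨B', hB'0, hB'⟩ : ∃ B' : ℝ, 0 < B' ∧ ∀ n, ∫ x, |F n x - g x| ^ r ∂ν ≤ B' := by
    obtain ⟨C, hC, h⟩ := add_rpow_le_one_add_mul hr one_pos
    have hle : ∀ n, ∫ x, |F n x - g x| ^ r ∂ν ≤ (1 + 1) * B + C * ∫ x, |g x| ^ r ∂ν := by
      intro n
      have := integral_mono (hd n) (((hF n).const_mul (1 + 1)).add (hg.const_mul C))
        (fun x => (Real.rpow_le_rpow (abs_nonneg _) (abs_sub (F n x) (g x)) (by linarith)).trans
          (h _ _ (abs_nonneg _) (abs_nonneg _)))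
      simp only [Pi.add_apply] at this
      rw [integral_add ((hF n).const_mul (1 + 1)) (hg.const_mul C), integral_const_mul,
        integral_const_mul] at this
      linarith [hB n]
    exact ⟨max 1 _, by positivity, fun n => (hle n).trans (le_max_right 1 _)⟩
  rw [Metric.tendsto_atTop]
  intro δ hδ
  set ε := δ / (2 * B') with hε
  have hε0 : 0 < ε := by positivity
  obtain ⟨C, hC, hineq⟩ := abs_rpow_add_sub_le hr hε0
  set Z : ℕ → α → ℝ := fun n x => |F n x| ^ r - |F n x - g x| ^ r - |g x| ^ r with hZ
  have hZi : ∀ n, Integrable (Z n) ν := fun n => ((hF n).sub (hd n)).sub hg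
  -- Removing ε|F_n - g|^r from the defect leaves a function dominated by the fixed C|g|^r. The
  -- removed part costs at most ε B' = δ/2 in the integral.
  set W : ℕ → α → ℝ := fun n x => max (|Z n x| - ε * |F n x - g x| ^ r) 0 with hW
  have hWi : ∀ n, Integrable (W n) ν := fun n =>
    ((hZi n).abs.sub ((hd n).const_mul ε)).pos_part
  have hWt : Tendsto (fun n => ∫ x, W n x ∂ν) atTop (𝓝 (∫ _, (0 : ℝ) ∂ν)) := by
    refine tendsto_integral_of_dominated_convergence (fun x => C * |g x| ^ r)
      (fun n => (hWi n).aestronglyMeasurable) (hg.const_mul C) ?_ ?_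
    · intro n
      refine ae_of_all _ fun x => ?_
      rw [Real.norm_of_nonneg (le_max_right _ _)]
      refine max_le ?_ (by positivity)
      have := hineq (F n x - g x) (g x)
      rw [sub_add_cancel] at this
      simp only [hZ]
      linarith
    · filter_upwards [hlim] with x hx
      have h0 : Tendsto (fun n => F n x - g x) atTop (𝓝 0) := by
        simpa using hx.sub_const (g x)
      have h1 : Tendsto (fun n => |F n x - g x| ^ r) atTop (𝓝 0) := by
        have := (h0.abs).rpow_const (p := r) (Or.inr (by linarith))
        simpa [Real.zero_rpow (by linarith : r ≠ 0)] using this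
      have h2 : Tendsto (fun n => |F n x| ^ r) atTop (𝓝 (|g x| ^ r)) :=
        (hx.abs).rpow_const (Or.inr (by linarith))
      have h3 : Tendsto (fun n => Z n x) atTop (𝓝 0) := by
        simpa using (h2.sub h1).sub_const (|g x| ^ r)
      have h4 := (h3.abs.sub (h1.const_mul ε)).max (tendsto_const_nhds (x := (0 : ℝ)))
      simpa using h4
  rw [integral_zero] at hWt
  obtain ⟨N, hN⟩ := Metric.tendsto_atTop.1 hWt (δ / 2) (by positivity)
  refine ⟨N, fun n hn => ?_⟩
  have e : ∫ x, |F n x| ^ r ∂ν - ∫ x, |F n x - g x| ^ r ∂ν - ∫ x, |g x| ^ r ∂ν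
      = ∫ x, Z n x ∂ν := by
    have e1 := integral_sub ((hF n).sub (hd n)) hg
    have e2 := integral_sub (hF n) (hd n)
    simp only [Pi.sub_apply] at e1
    rw [← e2, ← e1]
  rw [e, Real.dist_eq, sub_zero]
  have hWn := hN n hn
  rw [Real.dist_eq, sub_zero] at hWn
  calc |∫ x, Z n x ∂ν| ≤ ∫ x, |Z n x| ∂ν := abs_integral_le_integral_abs
    _ ≤ ∫ x, (W n x + ε * |F n x - g x| ^ r) ∂ν := by
        refine integral_mono (hZi n).abs ((hWi n).add ((hd n).const_mul ε)) fun x => ?_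
        have := le_max_left (|Z n x| - ε * |F n x - g x| ^ r) 0
        simp only [hW]
        linarith
    _ = ∫ x, W n x ∂ν + ε * ∫ x, |F n x - g x| ^ r ∂ν := by
        rw [integral_add (hWi n) ((hd n).const_mul ε), integral_const_mul]
    _ < δ / 2 + ε * B' :=
        add_lt_add_of_lt_of_le ((le_abs_self _).trans_lt hWn)
          (mul_le_mul_of_nonneg_left (hB' n) hε0.le)
    _ = δ := by rw [hε]; field_simp; ring

end BrezisLieb

/-! ### One-variable estimates -/

/-- A quadratic function dominates a power of an affine function with exponent below `2`. -/
theorem exists_bound_of_sq_sub_rpow_le {a b c q M : ℝ} (ha : 0 ≤ a) (hb : 0 ≤ b) (hc : 0 ≤ c)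
    (hq0 : 0 < q) (hq : q < 2) :
    ∃ S : ℝ, 0 ≤ S ∧ ∀ s : ℝ, 0 ≤ s → s ^ 2 / 2 - c * (a + b * s) ^ q ≤ M → s ≤ S := by
  set C := c * (a + b) ^ q with hC
  have hC0 : 0 ≤ C := by positivity
  -- For s ≥ 1 one has a + bs ≤ (a+b)s, so the expression is at least s^q (s^(2-q)/2 - C). Once
  -- s^(2-q) > t, this is at least |M| + 1.
  set t := 2 * (C + |M| + 1) with ht
  have ht0 : 0 < t := by positivity
  have hq2 : 0 < 2 - q := by linarith
  refine ⟨max 1 (t ^ (2 - q)⁻¹), by positivity, fun s hs hle => ?_⟩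
  by_contra! hlt
  obtain ⟨h1, h2⟩ := max_lt_iff.1 hlt
  have hs0 : 0 < s := by linarith
  have h3 : t < s ^ (2 - q) := by
    have := Real.rpow_lt_rpow (by positivity) h2 hq2
    rwa [← Real.rpow_mul ht0.le, inv_mul_cancel₀ hq2.ne', Real.rpow_one] at this
  have h4 : (a + b * s) ^ q ≤ (a + b) ^ q * s ^ q := by
    rw [← Real.mul_rpow (by positivity) hs]
    exact Real.rpow_le_rpow (by positivity) (by nlinarith) hq0.le
  have h5 : s ^ 2 = s ^ q * s ^ (2 - q) := by
    rw [← Real.rpow_add hs0, add_sub_cancel, Real.rpow_two]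
  have h6 : 1 ≤ s ^ q := Real.one_le_rpow h1.le hq0.le
  have h7 : c * (a + b * s) ^ q ≤ C * s ^ q := by
    rw [hC, mul_assoc]; exact mul_le_mul_of_nonneg_left h4 hc
  have h8 : s ^ q * t ≤ s ^ 2 := by rw [h5]; exact mul_le_mul_of_nonneg_left h3.le (by linarith)
  have h9 : |M| + 1 ≤ s ^ q * (|M| + 1) := le_mul_of_one_le_left (by positivity) h6
  have h10 := le_abs_self M
  rw [ht] at h8
  linarith

/-- Write w(x)² - w(y)² as the integral of 2ww', bound 2|ww'| by t w² + w'²/t, then average over y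
in [0, l]. The free parameter t serves to balance, or to suppress, the derivative term. -/
theorem AbsolutelyContinuousOnInterval.sq_le_integral {w : ℝ → ℝ} {l : ℝ} (hl : 0 < l)
    (hw : AbsolutelyContinuousOnInterval w 0 l)
    (hw' : IntegrableOn (fun x => deriv w x ^ 2) (Set.Icc 0 l)) {t : ℝ} (ht : 0 < t)
    {x : ℝ} (hx : x ∈ Set.Icc 0 l) :
    w x ^ 2 ≤ (1 / l + t) * (∫ y in Set.Icc 0 l, w y ^ 2)
      + (1 / t) * ∫ y in Set.Icc 0 l, deriv w y ^ 2 := by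
  have hcont : ContinuousOn w (Set.Icc 0 l) := by
    simpa [Set.uIcc_of_le hl.le] using hw.continuousOn
  have hw2 : IntegrableOn (fun x => w x ^ 2) (Set.Icc 0 l) :=
    (hcont.pow 2).integrableOn_compact isCompact_Icc
  set J : ℝ → ℝ := fun y => t * w y ^ 2 + (1 / t) * deriv w y ^ 2 with hJ
  have hJi : IntegrableOn J (Set.Icc 0 l) := (hw2.const_mul t).add (hw'.const_mul (1 / t))
  have hJ0 : ∀ y, 0 ≤ J y := fun y => by positivity
  have hstep : ∀ y ∈ Set.Icc 0 l, w x ^ 2 ≤ w y ^ 2 + ∫ z in Set.Icc 0 l, J z := by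
    intro y hy
    have hsub : Set.uIcc y x ⊆ Set.uIcc 0 l := by
      rw [Set.uIcc_of_le hl.le]; exact Set.uIcc_subset_Icc hy hx
    have hac := hw.mono hsub
    have hsub' : Set.uIoc y x ⊆ Set.Icc 0 l :=
      Set.uIoc_subset_uIcc.trans (Set.uIcc_subset_Icc hy hx)
    have h1 := hac.integral_deriv_mul_eq_sub hac
    have h2 : |∫ z in y..x, (deriv w z * w z + w z * deriv w z)| ≤ ∫ z in Set.Icc 0 l, J z := by
      rw [← Real.norm_eq_abs]
      refine (intervalIntegral.norm_integral_le_integral_norm_uIoc).trans ?_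
      calc ∫ z in Set.uIoc y x, ‖deriv w z * w z + w z * deriv w z‖
          ≤ ∫ z in Set.uIoc y x, J z := by
            refine integral_mono_of_nonneg (ae_of_all _ fun z => norm_nonneg _)
              (hJi.mono_set hsub') (ae_of_all _ fun z => ?_)
            simp only [hJ, Real.norm_eq_abs]
            rw [abs_le]
            have e1 : t * (w z + (1 / t) * deriv w z) ^ 2
                = t * w z ^ 2 + (1 / t) * deriv w z ^ 2
                  + (deriv w z * w z + w z * deriv w z) := by field_simp; ring
            have e2 : t * (w z - (1 / t) * deriv w z) ^ 2
                = t * w z ^ 2 + (1 / t) * deriv w z ^ 2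
                  - (deriv w z * w z + w z * deriv w z) := by field_simp; ring
            constructor
            · linarith [mul_nonneg ht.le (sq_nonneg (w z + (1 / t) * deriv w z))]
            · linarith [mul_nonneg ht.le (sq_nonneg (w z - (1 / t) * deriv w z))]
        _ ≤ ∫ z in Set.Icc 0 l, J z :=
            setIntegral_mono_set hJi (ae_of_all _ hJ0) hsub'.eventuallyLE
    rw [h1] at h2
    nlinarith [(abs_le.1 h2).2]
  have hint := setIntegral_mono_on (f := fun _ => w x ^ 2)
    (g := fun y => w y ^ 2 + ∫ z in Set.Icc 0 l, J z)
    (integrableOn_const (by simp)) (hw2.add (integrableOn_const (by simp)))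
    measurableSet_Icc hstep
  rw [integral_add hw2 (integrableOn_const (by simp))] at hint
  simp only [setIntegral_const, smul_eq_mul, measureReal_def, Real.volume_Icc, sub_zero,
    ENNReal.toReal_ofReal hl.le] at hint
  have hJe : ∫ z in Set.Icc 0 l, J z = t * (∫ z in Set.Icc 0 l, w z ^ 2)
      + (1 / t) * ∫ z in Set.Icc 0 l, deriv w z ^ 2 := by
    simp only [hJ]
    rw [integral_add (hw2.const_mul t) (hw'.const_mul (1 / t)), integral_const_mul,
      integral_const_mul]
  rw [hJe] at hint
  have : w x ^ 2 ≤ (1 / l) * (∫ z in Set.Icc 0 l, w z ^ 2) + (t * (∫ z in Set.Icc 0 l, w z ^ 2)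
      + (1 / t) * ∫ z in Set.Icc 0 l, deriv w z ^ 2) := by
    refine le_of_mul_le_mul_left ?_ hl
    refine hint.trans_eq ?_
    field_simp
  linarith

/-! ### Length measure and H¹ functions on a metric graph -/

theorem MeasurableEmbedding.sigmaMk {ι : Type*} {β : ι → Type*} [∀ i, MeasurableSpace (β i)]
    (i : ι) : MeasurableEmbedding (Sigma.mk i : β i → Sigma β) where
  injective := sigma_mk_injective
  measurable := fun s hs => by
    have := MeasurableSpace.measurableSet_iInf.1 hs i
    exact this
  measurableSet_image' := fun {s} hs => by
    refine MeasurableSpace.measurableSet_iInf.2 fun j => ?_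
    change MeasurableSet (Sigma.mk j ⁻¹' (Sigma.mk i '' s))
    by_cases h : i = j
    · subst h
      rwa [Set.preimage_image_eq _ sigma_mk_injective]
    · have : Sigma.mk j ⁻¹' (Sigma.mk i '' s) = ∅ := by
        ext y
        simp only [Set.mem_preimage, Set.mem_image, Set.mem_empty_iff_false, iff_false]
        rintro ⟨z, -, hz⟩
        exact h (congrArg Sigma.fst hz)
      rw [this]; exact MeasurableSet.empty

theorem MeasureTheory.MemLp.eLpNorm_two_sq {α : Type*} [MeasurableSpace α] {ν : Measure α}
    {F : α → ℝ} (hF : MemLp F 2 ν) :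
    eLpNorm F 2 ν ^ 2 = ENNReal.ofReal (∫ x, F x ^ 2 ∂ν) := by
  rw [hF.eLpNorm_eq_integral_rpow_norm (by simp) (by simp), ← ENNReal.ofReal_pow (by positivity)]
  congr 1
  simp only [ENNReal.toReal_ofNat, Real.rpow_two, Real.norm_eq_abs, sq_abs]
  rw [← Real.rpow_natCast, ← Real.rpow_mul (integral_nonneg fun x => sq_nonneg _)]
  norm_num

namespace MetricGraph

variable {G : MetricGraph.{u, v}}

theorem ae_vol_iff [Countable G.E] {Q : ((_ : G.E) × ℝ) → Prop} :
    (∀ᵐ q ∂G.vol, Q q) ↔ ∀ e, ∀ᵐ x ∂(volume.restrict (Set.Icc 0 (G.len e))), Q ⟨e, x⟩ := by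
  rw [vol, Measure.ae_sum_iff]
  exact forall_congr' fun e => (MeasurableEmbedding.sigmaMk e).ae_map_iff

theorem integrable_vol_edge {F : ((_ : G.E) × ℝ) → ℝ} (hF : Integrable F G.vol) (e : G.E) :
    IntegrableOn (fun x => F ⟨e, x⟩) (Set.Icc 0 (G.len e)) :=
  (MeasurableEmbedding.sigmaMk e).integrable_map_iff.1
    (hF.mono_measure (Measure.le_sum _ e))

theorem integral_edge_le {F : ((_ : G.E) × ℝ) → ℝ} (hF : Integrable F G.vol)
    (h0 : ∀ q, 0 ≤ F q) (e : G.E) :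
    ∫ x in Set.Icc 0 (G.len e), F ⟨e, x⟩ ≤ ∫ q, F q ∂G.vol := by
  rw [← (MeasurableEmbedding.sigmaMk e).integral_map (μ := volume.restrict _) F]
  exact integral_mono_measure (Measure.le_sum _ e) (ae_of_all _ h0) hF

theorem map_sigmaMk_le_vol (e : G.E) :
    (volume.restrict (Set.Icc 0 (G.len e))).map (Sigma.mk e) ≤ G.vol :=
  Measure.le_sum _ e

theorem exists_pt_eq (e : G.E) (x : ℝ) : ∃ y ∈ Set.Icc 0 (G.len e), G.pt e x = G.pt e y := by
  refine ⟨Set.projIcc 0 (G.len e) (G.len_pos e).le x, Subtype.coe_prop _, ?_⟩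
  simp only [pt, Set.projIcc_val]; rfl

theorem pt_zero (e : G.E) : G.pt e 0 = G.vertex (G.src e) := by
  refine (Quot.sound ?_).symm
  convert Glue.src e
  simp

theorem pt_len (e : G.E) : G.pt e (G.len e) = G.vertex (G.tgt e) := by
  refine (Quot.sound ?_).symm
  convert Glue.tgt e
  simp

/-- When no vertex is isolated, every point lies on an edge. -/
theorem exists_eq_pt (hG : ∀ a : G.V, ∃ e, G.src e = a ∨ G.tgt e = a) (q : G.Point) :
    ∃ (e : G.E), ∃ x ∈ Set.Icc 0 (G.len e), q = G.pt e x := by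
  induction q using Quot.ind with
  | mk s =>
    rcases s with a | ⟨e, x⟩
    · obtain ⟨e, he | he⟩ := hG a
      · exact ⟨e, 0, ⟨le_rfl, (G.len_pos e).le⟩, by rw [pt_zero, he]; rfl⟩
      · exact ⟨e, G.len e, ⟨(G.len_pos e).le, le_rfl⟩, by rw [pt_len, he]; rfl⟩
    · exact ⟨e, x, x.2, by simp only [pt, Set.projIcc_val]; rfl⟩

theorem continuous_of_continuousOn_edge {g : G.Point → ℝ}
    (hg : ∀ e, ContinuousOn (fun x => g (G.pt e x)) (Set.Icc 0 (G.len e))) : Continuous g := by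
  let : TopologicalSpace G.V := ⊥
  have hq : IsQuotientMap (Quot.mk G.Glue) := isQuotientMap_quot_mk
  refine hq.continuous_iff.2 (continuous_sum_dom.2 ⟨continuous_bot, continuous_sigma fun e => ?_⟩)
  refine (hg e).domRestrict.congr fun x => ?_
  simp only [Set.domRestrict, pt, Set.projIcc_val, Function.comp]

section H1

variable {f g : G.Point → ℝ}

theorem H1.continuous (hf : f ∈ G.H1) : Continuous f := hf.1
theorem H1.ac (hf : f ∈ G.H1) (e : G.E) :
    AbsolutelyContinuousOnInterval (fun x => f (G.pt e x)) 0 (G.len e) := hf.2.1 e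
theorem H1.memLp_coord (hf : f ∈ G.H1) : MemLp (G.coord f) 2 G.vol := hf.2.2.1
theorem H1.memLp_dcoord (hf : f ∈ G.H1) : MemLp (G.dcoord f) 2 G.vol := hf.2.2.2

theorem H1.ae_differentiableAt (hf : f ∈ G.H1) (e : G.E) :
    ∀ᵐ x ∂(volume.restrict (Set.Icc 0 (G.len e))), DifferentiableAt ℝ (fun x => f (G.pt e x)) x := by
  rw [ae_restrict_iff' measurableSet_Icc]
  simpa [Set.uIcc_of_le (G.len_pos e).le] using (H1.ac hf e).ae_differentiableAt

theorem H1.dcoord_sub [Countable G.E] (hf : f ∈ G.H1) (hg : g ∈ G.H1) :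
    G.dcoord (f - g) =ᵐ[G.vol] G.dcoord f - G.dcoord g := by
  refine ae_vol_iff.2 fun e => ?_
  filter_upwards [H1.ae_differentiableAt hf e, H1.ae_differentiableAt hg e] with x h1 h2
  exact deriv_sub h1 h2

theorem H1.sub [Countable G.E] (hf : f ∈ G.H1) (hg : g ∈ G.H1) : f - g ∈ G.H1 :=
  ⟨(H1.continuous hf).sub (H1.continuous hg), fun e => (H1.ac hf e).sub (H1.ac hg e),
    (H1.memLp_coord hf).sub (H1.memLp_coord hg),
    ((H1.memLp_dcoord hf).sub (H1.memLp_dcoord hg)).ae_eq (H1.dcoord_sub hf hg).symm⟩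

theorem dcoord_smul (c : ℝ) (f : G.Point → ℝ) : G.dcoord (c • f) = c • G.dcoord f := by
  funext q
  exact deriv_const_smul_field c _

theorem H1.smul (c : ℝ) (hf : f ∈ G.H1) : c • f ∈ G.H1 :=
  ⟨(H1.continuous hf).const_smul c, fun e => (H1.ac hf e).const_mul c,
    (H1.memLp_coord hf).const_smul c,
    by rw [dcoord_smul]; exact (H1.memLp_dcoord hf).const_smul c⟩

theorem H1.integrable_coord_sq (hf : f ∈ G.H1) : Integrable (fun q => G.coord f q ^ 2) G.vol :=
  (H1.memLp_coord hf).integrable_sq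
theorem H1.integrable_dcoord_sq (hf : f ∈ G.H1) : Integrable (fun q => G.dcoord f q ^ 2) G.vol :=
  (H1.memLp_dcoord hf).integrable_sq

theorem H1.sq_le_edge (hf : f ∈ G.H1) (e : G.E) (x : ℝ) {t : ℝ} (ht : 0 < t) :
    f (G.pt e x) ^ 2 ≤ (1 / G.len e + t) * (∫ y in Set.Icc 0 (G.len e), G.coord f ⟨e, y⟩ ^ 2)
      + (1 / t) * ∫ q, G.dcoord f q ^ 2 ∂G.vol := by
  obtain ⟨y, hy, hxy⟩ := G.exists_pt_eq e x
  rw [hxy]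
  have h1 := (H1.ac hf e).sq_le_integral (G.len_pos e)
    (integrable_vol_edge (H1.integrable_dcoord_sq hf) e) ht hy
  have h2 := integral_edge_le (H1.integrable_dcoord_sq hf) (fun q => sq_nonneg _) e
  have h3 := mul_le_mul_of_nonneg_left h2 (one_div_pos.2 ht).le
  exact h1.trans (add_le_add_right h3 _)

theorem H1.sq_le (hf : f ∈ G.H1) {l : ℝ} (hl0 : 0 < l) (hl : ∀ e, l ≤ G.len e)
    (e : G.E) (x : ℝ) {t : ℝ} (ht : 0 < t) :
    f (G.pt e x) ^ 2 ≤ (1 / l + t) * (∫ q, G.coord f q ^ 2 ∂G.vol)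
      + (1 / t) * ∫ q, G.dcoord f q ^ 2 ∂G.vol := by
  refine (H1.sq_le_edge hf e x ht).trans (add_le_add_left ?_ _)
  refine mul_le_mul ?_ (integral_edge_le (H1.integrable_coord_sq hf) (fun q => sq_nonneg _) e)
    (integral_nonneg fun x => sq_nonneg _) (by positivity)
  exact add_le_add_left (one_div_le_one_div_of_le hl0 (hl e)) _

end H1

end MetricGraph

/-! ### Weak compactness in H¹ of a graph -/

theorem AbsolutelyContinuousOnInterval.congr {w z : ℝ → ℝ} {a b : ℝ}
    (hw : AbsolutelyContinuousOnInterval w a b) (h : Set.EqOn w z (Set.uIcc a b)) :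
    AbsolutelyContinuousOnInterval z a b := by
  rw [absolutelyContinuousOnInterval_iff] at hw ⊢
  intro ε hε
  obtain ⟨δ, hδ, H⟩ := hw ε hε
  refine ⟨δ, hδ, fun E hE hlt => ?_⟩
  refine lt_of_eq_of_lt (Finset.sum_congr rfl fun i hi => ?_) (H E hE hlt)
  obtain ⟨h1, h2⟩ := hE.1 i hi
  rw [h h1, h h2]

theorem MeasureTheory.MemLp.norm_toLp_two_sq {α : Type*} [MeasurableSpace α] {ν : Measure α}
    {F : α → ℝ} (hF : MemLp F 2 ν) : ‖hF.toLp F‖ ^ 2 = ∫ x, F x ^ 2 ∂ν := by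
  rw [Lp.norm_toLp, ← ENNReal.toReal_pow, hF.eLpNorm_two_sq,
    ENNReal.toReal_ofReal (integral_nonneg fun x => sq_nonneg _)]

namespace MetricGraph

variable {G : MetricGraph.{u, v}}

theorem restrict_vol_image (e : G.E) {s : Set ℝ} (hs : MeasurableSet s)
    (hsub : s ⊆ Set.Icc 0 (G.len e)) :
    G.vol.restrict (Sigma.mk e '' s) = (volume.restrict s).map (Sigma.mk e) := by
  have hme := fun e' : G.E => MeasurableEmbedding.sigmaMk (β := fun _ : G.E => ℝ) e'
  ext T hT
  have hT' : MeasurableSet (T ∩ Sigma.mk e '' s) := hT.inter ((hme e).measurableSet_image.2 hs)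
  rw [Measure.restrict_apply hT, vol, Measure.sum_apply _ hT', tsum_eq_single e,
    (hme e).map_apply, (hme e).map_apply, Measure.restrict_apply ((hme e).measurable hT'),
    Measure.restrict_apply ((hme e).measurable hT), Set.preimage_inter,
    Set.preimage_image_eq _ (hme e).injective, Set.inter_assoc, Set.inter_eq_left.2 hsub]
  intro e' he'
  rw [(hme e').map_apply]
  have : Sigma.mk e' ⁻¹' (T ∩ Sigma.mk e '' s) = ∅ := by
    ext y
    simp only [Set.mem_preimage, Set.mem_inter_iff, Set.mem_image, Set.mem_empty_iff_false,
      iff_false]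
    rintro ⟨-, z, -, hz⟩
    exact he' (congrArg Sigma.fst hz).symm
  rw [this, measure_empty]

theorem integral_vol_image (e : G.E) {s : Set ℝ} (hs : MeasurableSet s)
    (hsub : s ⊆ Set.Icc 0 (G.len e)) (F : ((_ : G.E) × ℝ) → ℝ) :
    ∫ q in Sigma.mk e '' s, F q ∂G.vol = ∫ x in s, F ⟨e, x⟩ := by
  rw [restrict_vol_image e hs hsub, (MeasurableEmbedding.sigmaMk e).integral_map]

theorem vol_image_ne_top (e : G.E) {s : Set ℝ} (hs : MeasurableSet s)
    (hsub : s ⊆ Set.Icc 0 (G.len e)) : G.vol (Sigma.mk e '' s) ≠ ∞ := by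
  rw [← Measure.restrict_apply_univ, restrict_vol_image e hs hsub,
    (MeasurableEmbedding.sigmaMk e).map_apply]
  simp only [Set.preimage_univ, Measure.restrict_apply_univ]
  exact ((measure_mono hsub).trans_lt (by simp)).ne

theorem measurableSet_sigmaMk_image (e : G.E) {s : Set ℝ} (hs : MeasurableSet s) :
    MeasurableSet (Sigma.mk e '' s : Set ((_ : G.E) × ℝ)) :=
  (MeasurableEmbedding.sigmaMk e).measurableSet_image.2 hs

theorem intervalIntegrable_of_memLp_vol {h : ((_ : G.E) × ℝ) → ℝ} (hh : MemLp h 2 G.vol)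
    (e : G.E) : IntervalIntegrable (fun x => h ⟨e, x⟩) volume 0 (G.len e) := by
  have h1 : MemLp (h ∘ Sigma.mk e) 2 (volume.restrict (Set.Icc 0 (G.len e))) :=
    (MeasurableEmbedding.sigmaMk e).memLp_map_measure_iff.1
      (hh.mono_measure (map_sigmaMk_le_vol e))
  have h2 : IntegrableOn (h ∘ Sigma.mk e) (Set.Icc 0 (G.len e)) :=
    h1.integrable (by norm_num)
  exact (intervalIntegrable_iff_integrableOn_Icc_of_le (G.len_pos e).le).2 h2

/-- Increments along an edge are thus weakly continuous functionals of the derivative: this turns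
weak convergence of derivatives into pointwise convergence of functions. -/
theorem inner_indicator_eq (e : G.E) {x : ℝ} (hx : x ∈ Set.Icc 0 (G.len e))
    (F : Lp ℝ 2 G.vol) :
    inner ℝ F (indicatorConstLp 2
      (measurableSet_sigmaMk_image e (measurableSet_Icc (a := 0) (b := x)))
      (vol_image_ne_top e measurableSet_Icc (Set.Icc_subset_Icc_right hx.2)) (1 : ℝ))
      = ∫ y in (0 : ℝ)..x, F ⟨e, y⟩ := by
  rw [real_inner_comm, L2.inner_indicatorConstLp_one,
    integral_vol_image e measurableSet_Icc (Set.Icc_subset_Icc_right hx.2),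
    intervalIntegral.integral_of_le hx.1, integral_Icc_eq_integral_Ioc]

theorem intervalIntegral_congr_of_ae_eq [Countable G.E] {F F' : ((_ : G.E) × ℝ) → ℝ}
    (h : F =ᵐ[G.vol] F') (e : G.E) {x : ℝ} (hx : x ∈ Set.Icc 0 (G.len e)) :
    ∫ y in (0 : ℝ)..x, F ⟨e, y⟩ = ∫ y in (0 : ℝ)..x, F' ⟨e, y⟩ := by
  refine intervalIntegral.integral_congr_ae_restrict ?_
  rw [Set.uIoc_of_le hx.1]
  exact ae_restrict_of_ae_restrict_of_subset
    (Set.Ioc_subset_Icc_self.trans (Set.Icc_subset_Icc_right hx.2)) (ae_vol_iff.1 h e)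

theorem H1.eq_add_integral {f : G.Point → ℝ} (hf : f ∈ G.H1) (e : G.E) {x : ℝ}
    (hx : x ∈ Set.Icc 0 (G.len e)) :
    f (G.pt e x) = f (G.pt e 0) + ∫ y in (0 : ℝ)..x, G.dcoord f ⟨e, y⟩ := by
  have hsub : Set.uIcc 0 x ⊆ Set.uIcc 0 (G.len e) := by
    rw [Set.uIcc_of_le hx.1, Set.uIcc_of_le (G.len_pos e).le]
    exact Set.Icc_subset_Icc_right hx.2
  have := ((H1.ac hf e).mono hsub).integral_deriv_eq_sub
  simp only [dcoord]
  linarith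

/-- A continuous primitive on every edge of an `L²` function has this function as derivative. -/
theorem ac_and_dcoord_of_eq_add_integral [Countable G.E] {g : G.Point → ℝ}
    {h : ((_ : G.E) × ℝ) → ℝ} (hh : MemLp h 2 G.vol)
    (hg : ∀ e, ∀ x ∈ Set.Icc 0 (G.len e),
      g (G.pt e x) = g (G.pt e 0) + ∫ y in (0 : ℝ)..x, h ⟨e, y⟩) :
    (∀ e, AbsolutelyContinuousOnInterval (fun x => g (G.pt e x)) 0 (G.len e)) ∧
      G.dcoord g =ᵐ[G.vol] h := by
  constructor
  · intro e
    have h1 := (intervalIntegrable_of_memLp_vol hh e).absolutelyContinuousOnInterval_intervalIntegral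
      (c := 0) Set.left_mem_uIcc
    have h2 : AbsolutelyContinuousOnInterval (fun _ : ℝ => g (G.pt e 0)) 0 (G.len e) :=
      (LipschitzWith.const _ |>.lipschitzOnWith).absolutelyContinuousOnInterval
    refine (h2.add h1).congr fun x hx => ?_
    rw [Set.uIcc_of_le (G.len_pos e).le] at hx
    simp only [Pi.add_apply]
    exact (hg e x hx).symm
  · refine ae_vol_iff.2 fun e => ?_
    have h1 := (intervalIntegrable_of_memLp_vol hh e).ae_hasDerivAt_integral
    -- The end points are discarded as a null set: the primitive formula holds only inside the edge,
    -- whereas `deriv` needs a full neighbourhood.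
    rw [← restrict_Ioo_eq_restrict_Icc, ae_restrict_iff' measurableSet_Ioo]
    filter_upwards [h1] with x hx hxI
    have hxI' : x ∈ Set.uIcc 0 (G.len e) := by
      rw [Set.uIcc_of_le (G.len_pos e).le]; exact Set.Ioo_subset_Icc_self hxI
    have hd := (hx hxI' 0 Set.left_mem_uIcc).const_add (g (G.pt e 0))
    have heq : (fun y => g (G.pt e y)) =ᶠ[𝓝 x] fun y => g (G.pt e 0) + ∫ t in (0 : ℝ)..y, h ⟨e, t⟩ := by
      filter_upwards [Icc_mem_nhds hxI.1 hxI.2] with y hy using hg e y hy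
    exact (hd.congr_of_eventuallyEq heq).deriv

/-- Extract a weak limit h of the derivatives and, by compactness of a countable product, limits of
the values at the initial points of all edges. Integrating h gives pointwise limits everywhere.
Since the limit is taken at points of the quotient, its compatibility at the vertices is automatic.
-/
theorem exists_subseq_tendsto_of_bounded [Countable G.E]
    (hG : ∀ a : G.V, ∃ e, G.src e = a ∨ G.tgt e = a) {f : ℕ → G.Point → ℝ}
    (hf : ∀ n, f n ∈ G.H1) {M B A : ℝ} (hM : ∀ n e x, |f n (G.pt e x)| ≤ M)
    (hB : ∀ n, ∫ q, G.coord (f n) q ^ 2 ∂G.vol ≤ B)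
    (hA : ∀ n, ∫ q, G.dcoord (f n) q ^ 2 ∂G.vol ≤ A) :
    ∃ g ∈ G.H1, ∃ φ : ℕ → ℕ, StrictMono φ ∧
      (∀ q, Tendsto (fun n => f (φ n) q) atTop (𝓝 (g q))) ∧
      Tendsto (fun n => ∫ q, G.dcoord (f (φ n)) q ^ 2 ∂G.vol
        - ∫ q, G.dcoord (f (φ n) - g) q ^ 2 ∂G.vol) atTop
        (𝓝 (∫ q, G.dcoord g q ^ 2 ∂G.vol)) := by
  set D : ℕ → Lp ℝ 2 G.vol := fun n => (H1.memLp_dcoord (hf n)).toLp _ with hD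
  have hDn : ∀ n, ‖D n‖ ≤ √A := fun n =>
    Real.le_sqrt_of_sq_le (((H1.memLp_dcoord (hf n)).norm_toLp_two_sq).trans_le (hA n))
  obtain ⟨h, φ₁, hφ₁, hweak⟩ := exists_subseq_tendsto_inner_of_bounded D hDn
  obtain ⟨a, -, φ₂, hφ₂, ha⟩ :=
    (isCompact_univ_pi fun _ : G.E => isCompact_Icc (a := -M) (b := M)).isSeqCompact
      (x := fun n e => f (φ₁ n) (G.pt e 0)) (fun n e _ => abs_le.1 (hM _ e 0))
  set φ := φ₁ ∘ φ₂ with hφ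
  have hweak' : ∀ y, Tendsto (fun n => inner ℝ (D (φ n)) y) atTop (𝓝 (inner ℝ h y)) := fun y =>
    (hweak y).comp hφ₂.tendsto_atTop
  have hinc : ∀ n e, ∀ x ∈ Set.Icc 0 (G.len e),
      f n (G.pt e x) = f n (G.pt e 0) + ∫ y in (0 : ℝ)..x, D n ⟨e, y⟩ := by
    intro n e x hx
    rw [H1.eq_add_integral (hf n) e hx,
      intervalIntegral_congr_of_ae_eq (MemLp.coeFn_toLp (H1.memLp_dcoord (hf n))) e hx]
  have hlim : ∀ e, ∀ x ∈ Set.Icc 0 (G.len e), Tendsto (fun n => f (φ n) (G.pt e x)) atTop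
      (𝓝 (a e + ∫ y in (0 : ℝ)..x, h ⟨e, y⟩)) := by
    intro e x hx
    have h1 := (tendsto_pi_nhds.1 ha e).add (hweak' (indicatorConstLp 2
      (measurableSet_sigmaMk_image e (measurableSet_Icc (a := 0) (b := x)))
      (vol_image_ne_top e measurableSet_Icc (Set.Icc_subset_Icc_right hx.2)) (1 : ℝ)))
    rw [inner_indicator_eq e hx] at h1
    refine h1.congr fun n => ?_
    rw [hinc (φ n) e x hx, inner_indicator_eq e hx]
    rfl
  have hex : ∀ q : G.Point, ∃ c, Tendsto (fun n => f (φ n) q) atTop (𝓝 c) := by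
    intro q
    obtain ⟨e, x, hx, rfl⟩ := G.exists_eq_pt hG q
    exact ⟨_, hlim e x hx⟩
  choose g hg using hex
  have hgeq : ∀ e, ∀ x ∈ Set.Icc 0 (G.len e),
      g (G.pt e x) = g (G.pt e 0) + ∫ y in (0 : ℝ)..x, h ⟨e, y⟩ := by
    intro e x hx
    have h0 := tendsto_nhds_unique (hg (G.pt e 0)) (hlim e 0 ⟨le_rfl, (G.len_pos e).le⟩)
    rw [intervalIntegral.integral_same, add_zero] at h0
    rw [h0]
    exact tendsto_nhds_unique (hg _) (hlim e x hx)
  obtain ⟨hac, hder⟩ := ac_and_dcoord_of_eq_add_integral (Lp.memLp h) hgeq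
  have hcont : Continuous g := continuous_of_continuousOn_edge fun e => by
    simpa [Set.uIcc_of_le (G.len_pos e).le] using (hac e).continuousOn
  have hcoord : MemLp (G.coord g) 2 G.vol := by
    have hae : ∀ᵐ q ∂G.vol, Tendsto (fun n => G.coord (f (φ n)) q) atTop (𝓝 (G.coord g q)) :=
      ae_of_all _ fun q => hg _
    refine ⟨aestronglyMeasurable_of_tendsto_ae atTop
      (fun n => (H1.memLp_coord (hf (φ n))).1) hae, ?_⟩
    -- Fatou's lemma: the L² bound passes to the pointwise limit.
    refine (Lp.eLpNorm_lim_le_liminf_eLpNorm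
      (fun n => (H1.memLp_coord (hf (φ n))).1) _ hae).trans_lt ?_
    refine (liminf_le_of_frequently_le' (x := ENNReal.ofReal √B)
      (Frequently.of_forall fun n => ?_)).trans_lt ENNReal.ofReal_lt_top
    refine (ENNReal.pow_le_pow_left_iff two_ne_zero).1 ?_
    rw [(H1.memLp_coord (hf (φ n))).eLpNorm_two_sq, ← ENNReal.ofReal_pow (Real.sqrt_nonneg _)]
    refine ENNReal.ofReal_le_ofReal ?_
    rw [Real.sq_sqrt ((integral_nonneg fun x => sq_nonneg _).trans (hB 0))]
    exact hB _
  have hgH : g ∈ G.H1 := ⟨hcont, hac, hcoord, (Lp.memLp h).ae_eq hder.symm⟩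
  refine ⟨g, hgH, φ, hφ₁.comp hφ₂, hg, ?_⟩
  have hh : h = (H1.memLp_dcoord hgH).toLp _ := by
    rw [← Lp.toLp_coeFn h (Lp.memLp h)]
    exact (MemLp.toLp_eq_toLp_iff _ _).2 hder.symm
  have hsub : ∀ n, D n - h = (H1.memLp_dcoord (H1.sub (hf n) hgH)).toLp _ := by
    intro n
    rw [hh, hD, ← MemLp.toLp_sub]
    exact (MemLp.toLp_eq_toLp_iff _ _).2 (H1.dcoord_sub (hf n) hgH).symm
  -- ‖D_n‖² - ‖D_n - h‖² = 2⟨D_n, h⟩ - ‖h‖², which weak convergence sends to ‖h‖².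
  have hlast := ((hweak' h).const_mul 2).sub_const (‖h‖ ^ 2)
  have e1 : 2 * inner ℝ h h - ‖h‖ ^ 2 = ∫ q, G.dcoord g q ^ 2 ∂G.vol := by
    rw [← (H1.memLp_dcoord hgH).norm_toLp_two_sq, ← hh, real_inner_self_eq_norm_sq]; ring
  rw [e1] at hlast
  refine hlast.congr fun n => ?_
  rw [← (H1.memLp_dcoord (H1.sub (hf _) hgH)).norm_toLp_two_sq, ← hsub,
    ← (H1.memLp_dcoord (hf _)).norm_toLp_two_sq, norm_sub_sq_real]
  ring

end MetricGraph

/-! ### Energy bounds and scaling -/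

namespace MetricGraph

variable {G : MetricGraph.{u, v}} {f g w : G.Point → ℝ} {p μ : ℝ}

theorem energy_eq (p : ℝ) (f : G.Point → ℝ) : G.energy p f =
    (1 / 2) * ∫ q, G.dcoord f q ^ 2 ∂G.vol - (1 / p) * ∫ q, |G.coord f q| ^ p ∂G.vol := by
  simp only [energy, sq_abs]

theorem H1.integrable_abs_rpow_and_le (hf : f ∈ G.H1) (hp : 2 < p) {M : ℝ}
    (hM : ∀ᵐ q ∂G.vol, |G.coord f q| ≤ M) :
    Integrable (fun q => |G.coord f q| ^ p) G.vol ∧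
      ∫ q, |G.coord f q| ^ p ∂G.vol ≤ M ^ (p - 2) * ∫ q, G.coord f q ^ 2 ∂G.vol := by
  have hdom := (H1.integrable_coord_sq hf).const_mul (M ^ (p - 2))
  have hle : ∀ᵐ q ∂G.vol, |G.coord f q| ^ p ≤ M ^ (p - 2) * G.coord f q ^ 2 := by
    filter_upwards [hM] with q hq
    have e : |G.coord f q| ^ p = |G.coord f q| ^ (p - 2) * G.coord f q ^ 2 := by
      rw [← sq_abs (G.coord f q), ← Real.rpow_two,
        ← Real.rpow_add_of_nonneg (abs_nonneg _) (by linarith) (by norm_num), sub_add_cancel]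
    rw [e]
    exact mul_le_mul_of_nonneg_right (Real.rpow_le_rpow (abs_nonneg _) hq (by linarith))
      (sq_nonneg _)
  have hint : Integrable (fun q => |G.coord f q| ^ p) G.vol := by
    refine hdom.mono'
      ((H1.memLp_coord hf).1.aemeasurable.abs.pow_const p).aestronglyMeasurable ?_
    filter_upwards [hle] with q hq
    rwa [Real.norm_of_nonneg (by positivity)]
  refine ⟨hint, ?_⟩
  rw [← integral_const_mul]
  exact integral_mono_ae hint hdom hle

/-- A Gagliardo–Nirenberg type bound from t = 1 + ‖f'‖₂: at fixed mass, f² grows only linearly in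
‖f'‖₂. -/
theorem H1.abs_le (hf : f ∈ G.H1) {l : ℝ} (hl0 : 0 < l) (hl : ∀ e, l ≤ G.len e)
    (e : G.E) (x : ℝ) :
    |f (G.pt e x)| ≤ √((1 / l + 1) * (∫ q, G.coord f q ^ 2 ∂G.vol)
      + (∫ q, G.coord f q ^ 2 ∂G.vol + 1) * √(∫ q, G.dcoord f q ^ 2 ∂G.vol)) := by
  have hA : 0 ≤ ∫ q, G.dcoord f q ^ 2 ∂G.vol := integral_nonneg fun q => sq_nonneg _
  set A := ∫ q, G.dcoord f q ^ 2 ∂G.vol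
  set m := ∫ q, G.coord f q ^ 2 ∂G.vol
  have hs := Real.sqrt_nonneg A
  refine Real.le_sqrt_of_sq_le ?_
  rw [sq_abs]
  have h := H1.sq_le hf hl0 hl e x (t := 1 + √A) (by positivity)
  have h2 : 1 / (1 + √A) * A ≤ √A := by
    rw [one_div, inv_mul_le_iff₀ (by positivity)]
    nlinarith [Real.sq_sqrt hA]
  change _ ≤ (1 / l + (1 + √A)) * m + 1 / (1 + √A) * A at h
  linarith

/-- Sublevels of the energy at fixed mass are bounded in the subcritical case. -/
theorem exists_bound_of_energy_le {l : ℝ} (hl0 : 0 < l) (hl : ∀ e, l ≤ G.len e) (hp2 : 2 < p)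
    (hp6 : p < 6) (hμ : 0 < μ) (E₀ : ℝ) :
    ∃ A M : ℝ, 0 ≤ A ∧ 0 ≤ M ∧ ∀ f ∈ G.H1Mass μ, G.energy p f ≤ E₀ →
      ∫ q, G.dcoord f q ^ 2 ∂G.vol ≤ A ∧ ∀ e x, |f (G.pt e x)| ≤ M := by
  have ha : 0 ≤ (1 / l + 1) * μ := by positivity
  have hb : 0 ≤ μ + 1 := by linarith
  -- With s = ‖f'‖₂, the potential term is at most a constant times (a + bs)^((p-2)/2). The exponent
  -- is below 2 exactly when p < 6.
  obtain ⟨S, hS0, hS⟩ := exists_bound_of_sq_sub_rpow_le (M := E₀) (q := (p - 2) / 2)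
    (c := 1 / p * μ) ha hb (by positivity) (by linarith) (by linarith)
  refine ⟨S ^ 2, √((1 / l + 1) * μ + (μ + 1) * S), by positivity, by positivity,
    fun f ⟨hf, hm⟩ hE => ?_⟩
  have hA : 0 ≤ ∫ q, G.dcoord f q ^ 2 ∂G.vol := integral_nonneg fun q => sq_nonneg _
  have hbd := fun e x => H1.abs_le hf hl0 hl e x
  rw [hm] at hbd
  rw [energy_eq] at hE
  set A := ∫ q, G.dcoord f q ^ 2 ∂G.vol
  have hpot := (H1.integrable_abs_rpow_and_le hf hp2
    (ae_of_all _ fun q => hbd q.1 q.2)).2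
  rw [hm] at hpot
  have hpow : √((1 / l + 1) * μ + (μ + 1) * √A) ^ (p - 2)
      = ((1 / l + 1) * μ + (μ + 1) * √A) ^ ((p - 2) / 2) := by
    rw [Real.sqrt_eq_rpow, ← Real.rpow_mul (by positivity)]
    congr 1; ring
  rw [hpow] at hpot
  have hAS : √A ≤ S := by
    refine hS _ (Real.sqrt_nonneg _) ?_
    rw [Real.sq_sqrt hA]
    have := mul_le_mul_of_nonneg_left hpot (by positivity : 0 ≤ 1 / p)
    linarith
  refine ⟨(Real.sqrt_le_left hS0).1 hAS, fun e x => (hbd e x).trans (Real.sqrt_le_sqrt ?_)⟩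
  have := mul_le_mul_of_nonneg_left hAS hb
  linarith

theorem integral_coord_sq_smul (c : ℝ) (w : G.Point → ℝ) :
    ∫ q, G.coord (c • w) q ^ 2 ∂G.vol = c ^ 2 * ∫ q, G.coord w q ^ 2 ∂G.vol := by
  rw [← integral_const_mul]
  refine integral_congr_ae (ae_of_all _ fun q => ?_)
  simp only [coord, Pi.smul_apply, smul_eq_mul, mul_pow]

theorem energy_smul {c : ℝ} (hc : 0 ≤ c) (p : ℝ) (w : G.Point → ℝ) :
    G.energy p (c • w) = (1 / 2) * (c ^ 2 * ∫ q, G.dcoord w q ^ 2 ∂G.vol)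
      - (1 / p) * (c ^ p * ∫ q, |G.coord w q| ^ p ∂G.vol) := by
  rw [energy_eq, dcoord_smul, ← integral_const_mul (c ^ 2), ← integral_const_mul (c ^ p)]
  congr 2
  · refine integral_congr_ae (ae_of_all _ fun q => ?_)
    simp only [Pi.smul_apply, smul_eq_mul, mul_pow]
  · refine integral_congr_ae (ae_of_all _ fun q => ?_)
    simp only [coord, Pi.smul_apply, smul_eq_mul, abs_mul, abs_of_nonneg hc]
    rw [Real.mul_rpow hc (abs_nonneg _)]

theorem coord_ae_eq_zero_iff (hf : f ∈ G.H1) :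
    G.coord f =ᵐ[G.vol] 0 ↔ ∫ q, G.coord f q ^ 2 ∂G.vol = 0 := by
  rw [integral_eq_zero_iff_of_nonneg (fun q => sq_nonneg _) (H1.integrable_coord_sq hf)]
  refine eventually_congr (ae_of_all _ fun q => ?_)
  simp

theorem le_energy_of_level_eq {L : ℝ} (hL : G.level p μ = L) (hw : w ∈ G.H1Mass μ) :
    L ≤ G.energy p w := by
  have : G.level p μ ≤ G.energy p w := iInf₂_le w hw
  rw [hL] at this
  exact EReal.coe_le_coe_iff.1 this

/-- Multiplying w by c = √(μ/m) > 1 brings its mass m to μ. The potential part scales by c^p > c²,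
so L ≤ E(cw) < c² E(w). -/
theorem lt_energy_of_mass_lt {L : ℝ} (hL : G.level p μ = L) (hp : 2 < p) (hw : w ∈ G.H1)
    (hwp : Integrable (fun q => |G.coord w q| ^ p) G.vol)
    (h0 : 0 < ∫ q, G.coord w q ^ 2 ∂G.vol) (h1 : ∫ q, G.coord w q ^ 2 ∂G.vol < μ) :
    (∫ q, G.coord w q ^ 2 ∂G.vol) / μ * L < G.energy p w := by
  have hpot : 0 < ∫ q, |G.coord w q| ^ p ∂G.vol := by
    refine (integral_nonneg fun q => by positivity).lt_of_ne' fun hz => h0.ne' ?_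
    rw [integral_eq_zero_iff_of_nonneg (fun q => by positivity) hwp] at hz
    refine (coord_ae_eq_zero_iff hw).1 ?_
    filter_upwards [hz] with q hq
    exact abs_eq_zero.1 (((Real.rpow_eq_zero_iff_of_nonneg (abs_nonneg _)).1 hq).1)
  set m := ∫ q, G.coord w q ^ 2 ∂G.vol with hm
  have hμ : 0 < μ := h0.trans h1
  set c := √(μ / m) with hc
  have hc2 : c ^ 2 = μ / m := Real.sq_sqrt (by positivity)
  have hc1 : 1 < c := by
    rw [hc, Real.lt_sqrt (by norm_num), one_pow, one_lt_div h0]; exact h1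
  have hc0 : 0 < c := by linarith
  have hmem : c • w ∈ G.H1Mass μ := by
    refine ⟨H1.smul c hw, ?_⟩
    rw [integral_coord_sq_smul, hc2, ← hm]
    field_simp
  have hle := le_energy_of_level_eq hL hmem
  rw [energy_smul hc0.le] at hle
  have hcp : c ^ 2 < c ^ p := by
    rw [← Real.rpow_two]; exact Real.rpow_lt_rpow_of_exponent_lt hc1 hp
  have hlt : L < c ^ 2 * G.energy p w := by
    refine hle.trans_lt ?_
    rw [energy_eq]
    have := mul_lt_mul_of_pos_right hcp hpot
    have h3 := mul_lt_mul_of_pos_left this (by positivity : 0 < 1 / p)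
    linarith
  rw [hc2] at hlt
  have := mul_lt_mul_of_pos_left hlt (by positivity : 0 < m / μ)
  refine this.trans_eq ?_
  field_simp

theorem le_energy_of_mass_le {L : ℝ} (hL : G.level p μ = L) (hp : 2 < p) (hμ : 0 < μ)
    (hw : w ∈ G.H1) (hwp : Integrable (fun q => |G.coord w q| ^ p) G.vol)
    (h1 : ∫ q, G.coord w q ^ 2 ∂G.vol ≤ μ) :
    (∫ q, G.coord w q ^ 2 ∂G.vol) / μ * L ≤ G.energy p w := by
  have h0 : 0 ≤ ∫ q, G.coord w q ^ 2 ∂G.vol := integral_nonneg fun q => sq_nonneg _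
  rcases h0.eq_or_lt with h0 | h0
  · have hz := (coord_ae_eq_zero_iff hw).2 h0.symm
    have hpot : ∫ q, |G.coord w q| ^ p ∂G.vol = 0 := by
      refine integral_eq_zero_of_ae ?_
      filter_upwards [hz] with q hq
      simp [hq, Real.zero_rpow (by linarith : p ≠ 0)]
    rw [← h0, energy_eq, hpot]
    have : 0 ≤ ∫ q, G.dcoord w q ^ 2 ∂G.vol := integral_nonneg fun q => sq_nonneg _
    simp only [zero_div, zero_mul, mul_zero, sub_zero]
    positivity
  · rcases h1.eq_or_lt with h1 | h1
    · rw [h1, div_self hμ.ne', one_mul]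
      exact le_energy_of_level_eq hL ⟨hw, h1⟩
    · exact (lt_energy_of_mass_lt hL hp hw hwp h0 h1).le

theorem level_ne_bot {l : ℝ} (hl0 : 0 < l) (hl : ∀ e, l ≤ G.len e) (hp2 : 2 < p)
    (hp6 : p < 6) (hμ : 0 < μ) : G.level p μ ≠ ⊥ := by
  obtain ⟨A, M, -, hM0, h⟩ := exists_bound_of_energy_le (G := G) hl0 hl hp2 hp6 hμ 0
  have hlow : ((-(1 / p * (M ^ (p - 2) * μ)) : ℝ) : EReal) ≤ G.level p μ := by
    refine le_iInf₂ fun f hf => EReal.coe_le_coe_iff.2 ?_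
    have hneg : -(1 / p * (M ^ (p - 2) * μ)) ≤ 0 := by
      have : 0 ≤ 1 / p * (M ^ (p - 2) * μ) := by positivity
      linarith
    rcases le_total (G.energy p f) 0 with hE | hE
    · have h2 := (H1.integrable_abs_rpow_and_le hf.1 hp2
        (ae_of_all _ fun q => (h f hf hE).2 q.1 q.2)).2
      rw [hf.2] at h2
      have h3 := mul_le_mul_of_nonneg_left h2 (by positivity : 0 ≤ 1 / p)
      have h4 : 0 ≤ ∫ q, G.dcoord f q ^ 2 ∂G.vol := integral_nonneg fun q => sq_nonneg _
      rw [energy_eq]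
      linarith
    · linarith
  intro hbot
  rw [hbot] at hlow
  exact absurd (le_bot_iff.1 hlow) (EReal.coe_ne_bot _)

theorem H1.h1Norm_eq (hf : f ∈ G.H1) :
    G.h1Norm f = ENNReal.ofReal (∫ q, G.coord f q ^ 2 ∂G.vol + ∫ q, G.dcoord f q ^ 2 ∂G.vol)
      ^ (1 / 2 : ℝ) := by
  rw [h1Norm, (H1.memLp_coord hf).eLpNorm_two_sq, (H1.memLp_dcoord hf).eLpNorm_two_sq,
    ENNReal.ofReal_add (integral_nonneg fun q => sq_nonneg _) (integral_nonneg fun q => sq_nonneg _)]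

/-- With zero mass, the pointwise bound reads f² ≤ A/t for every t > 0. Points not on any edge would
escape it, hence the condition on vertices. -/
theorem H1.eq_zero_of_mass_eq_zero (hG : ∀ a : G.V, ∃ e, G.src e = a ∨ G.tgt e = a)
    (hf : f ∈ G.H1) {l : ℝ} (hl0 : 0 < l) (hl : ∀ e, l ≤ G.len e)
    (h : ∫ q, G.coord f q ^ 2 ∂G.vol = 0) (q : G.Point) : f q = 0 := by
  obtain ⟨e, x, -, rfl⟩ := G.exists_eq_pt hG q
  have hA : 0 ≤ ∫ q, G.dcoord f q ^ 2 ∂G.vol := integral_nonneg fun q => sq_nonneg _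
  have hle := fun (t : ℝ) (ht : 0 < t) => H1.sq_le hf hl0 hl e x ht
  simp only [h, mul_zero, zero_add] at hle
  by_contra hne
  have hpos : 0 < f (G.pt e x) ^ 2 := by positivity
  set A := ∫ q, G.dcoord f q ^ 2 ∂G.vol
  set y := f (G.pt e x) ^ 2
  have h1 := hle ((A + 1) / y) (by positivity)
  have h2 : 1 / ((A + 1) / y) * A = y * (A / (A + 1)) := by field_simp
  have h3 : A / (A + 1) < 1 := (div_lt_one (by linarith)).2 (by linarith)
  rw [h2] at h1
  nlinarith

/-- The maximum with 0 reflects that `ENNReal.ofReal` sends negative numbers to 0. -/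
theorem ae_abs_coord_le_of_eLpNorm_top {y : ℝ}
    (h : eLpNorm (G.coord f) ∞ G.vol = ENNReal.ofReal y) :
    ∀ᵐ q ∂G.vol, |G.coord f q| ≤ max y 0 := by
  rw [eLpNorm_exponent_top] at h
  filter_upwards [enorm_ae_le_eLpNormEssSup (G.coord f) G.vol] with q hq
  rw [h, Real.enorm_eq_ofReal_abs] at hq
  have := ENNReal.toReal_mono ENNReal.ofReal_ne_top hq
  rwa [ENNReal.toReal_ofReal (abs_nonneg _), ENNReal.toReal_ofReal'] at this

/-- A bounded sequence in `H¹` which vanishes pointwise vanishes uniformly on finitely many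
edges. -/
theorem eventually_sq_lt_of_tendsto_zero {f : ℕ → G.Point → ℝ}
    (hf : ∀ n, f n ∈ G.H1) {M A : ℝ} (hA0 : 0 ≤ A) (hM : ∀ n e x, |f n (G.pt e x)| ≤ M)
    (hA : ∀ n, ∫ q, G.dcoord (f n) q ^ 2 ∂G.vol ≤ A) (s : Finset G.E)
    (hlim : ∀ q, Tendsto (fun n => f n q) atTop (𝓝 0)) {δ : ℝ} (hδ : 0 < δ) :
    ∀ᶠ n in atTop, ∀ e ∈ s, ∀ x, f n (G.pt e x) ^ 2 < δ := by
  refine (Filter.eventually_all_finset s).2 fun e _ => ?_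
  have hm : Tendsto (fun n => ∫ y in Set.Icc 0 (G.len e), G.coord (f n) ⟨e, y⟩ ^ 2) atTop
      (𝓝 (∫ _ in Set.Icc 0 (G.len e), (0 : ℝ))) := by
    refine tendsto_integral_of_dominated_convergence (fun _ => M ^ 2)
      (fun n => (integrable_vol_edge (H1.integrable_coord_sq (hf n)) e).aestronglyMeasurable)
      (integrableOn_const (by simp)) (fun n => ae_of_all _ fun y => ?_)
      (ae_of_all _ fun y => ?_)
    · rw [Real.norm_of_nonneg (sq_nonneg _)]
      obtain ⟨h1, h2⟩ := _root_.abs_le.1 (hM n e y)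
      exact sq_le_sq' h1 h2
    · simpa [coord] using (hlim (G.pt e y)).pow 2
  rw [integral_zero] at hm
  -- This makes the derivative term A/t smaller than δ for all n at once; with t fixed, the mass on
  -- the edge tends to 0.
  set t := (A + 1) / δ with ht
  have ht0 : 0 < t := by positivity
  have h1 := (hm.const_mul (1 / G.len e + t)).add_const (1 / t * A)
  have h2 : (1 / G.len e + t) * 0 + 1 / t * A < δ := by
    have e1 : (1 / G.len e + t) * 0 + 1 / t * A = δ * (A / (A + 1)) := by
      rw [ht]; field_simp; ring
    have h3 : A / (A + 1) < 1 := (div_lt_one (by linarith)).2 (by linarith)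
    rw [e1]
    nlinarith
  filter_upwards [h1.eventually_lt_const h2] with n hn x
  refine (H1.sq_le_edge (hf n) e x ht0).trans_lt (lt_of_le_of_lt ?_ hn)
  exact add_le_add le_rfl (mul_le_mul_of_nonneg_left (hA n) (by positivity))

/-! ### Excluding vanishing and dichotomy -/

/-- Minimizing sequences with negative level whose maxima stay on finitely many edges have
a strongly convergent subsequence. -/
theorem exists_isGroundState_of_isMinimizingSeq [Countable G.E]
    (hG : ∀ a : G.V, ∃ e, G.src e = a ∨ G.tgt e = a) {l : ℝ} (hl0 : 0 < l)
    (hl : ∀ e, l ≤ G.len e) (hp2 : 2 < p) (hp6 : p < 6) (hμ : 0 < μ)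
    (hneg : G.level p μ < 0) {f : ℕ → G.Point → ℝ} (hf : G.IsMinimizingSeq p μ f)
    (s : Finset G.E)
    (hmax : ∀ n, ∃ e ∈ s, ∃ x,
      eLpNorm (G.coord (f n)) ∞ G.vol = ENNReal.ofReal (f n (G.pt e x))) :
    ∃ g : G.Point → ℝ, G.IsGroundState p μ g ∧ ∃ φ : ℕ → ℕ, StrictMono φ ∧
      Tendsto (fun n => G.h1Norm (f (φ n) - g)) atTop (𝓝 0) := by
  obtain ⟨hmass, hE⟩ := hf
  have hp0 : 0 < p := by linarith
  obtain ⟨L, hL⟩ : ∃ L : ℝ, G.level p μ = L :=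
    ⟨_, (EReal.coe_toReal (hneg.trans EReal.zero_lt_top).ne
      (level_ne_bot hl0 hl hp2 hp6 hμ)).symm⟩
  have hL0 : L < 0 := by rw [hL] at hneg; exact_mod_cast hneg
  rw [hL, EReal.tendsto_coe] at hE
  obtain ⟨E₀, hE₀⟩ := hE.bddAbove_range
  obtain ⟨A, M, hA0, hM0, hbd⟩ := exists_bound_of_energy_le (G := G) hl0 hl hp2 hp6 hμ E₀
  have hA := fun n => (hbd (f n) (hmass n) (hE₀ ⟨n, rfl⟩)).1
  have hM := fun n => (hbd (f n) (hmass n) (hE₀ ⟨n, rfl⟩)).2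
  obtain ⟨g, hg, φ, hφ, hlim, hkin⟩ := exists_subseq_tendsto_of_bounded hG
    (fun n => (hmass n).1) hM (fun n => (hmass n).2.le) hA
  have hgM : ∀ e x, |g (G.pt e x)| ≤ M := fun e x =>
    le_of_tendsto' (hlim (G.pt e x)).abs fun n => hM _ e x
  have hsubH : ∀ n, f (φ n) - g ∈ G.H1 := fun n => H1.sub (hmass _).1 hg
  have hsubM : ∀ n, ∀ᵐ q ∂G.vol, |G.coord (f (φ n) - g) q| ≤ M + M := fun n =>
    ae_of_all _ fun q => (abs_sub _ _).trans (add_le_add (hM _ q.1 q.2) (hgM q.1 q.2))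
  have hfpot := fun n => H1.integrable_abs_rpow_and_le (hmass n).1 hp2
    (ae_of_all _ fun q => hM n q.1 q.2)
  have hgpot := H1.integrable_abs_rpow_and_le hg hp2 (ae_of_all _ fun q => hgM q.1 q.2)
  have hspot := fun n => H1.integrable_abs_rpow_and_le (hsubH n) hp2
    (hsubM n)
  have hE' : Tendsto (fun n => G.energy p (f (φ n))) atTop (𝓝 L) := hE.comp hφ.tendsto_atTop
  have hlim_ae : ∀ᵐ q ∂G.vol, Tendsto (fun n => G.coord (f (φ n)) q) atTop (𝓝 (G.coord g q)) :=
    ae_of_all _ fun q => hlim _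
  have hmassLim : Tendsto (fun n => ∫ q, G.coord (f (φ n) - g) q ^ 2 ∂G.vol) atTop
      (𝓝 (μ - ∫ q, G.coord g q ^ 2 ∂G.vol)) := by
    have h := tendsto_integral_brezisLieb (r := 2) (by norm_num) (B := μ)
      (fun n => (H1.memLp_coord (hmass (φ n)).1).1) (H1.memLp_coord hg).1
      (fun n => by
        simpa only [Real.rpow_two, sq_abs] using H1.integrable_coord_sq (hmass (φ n)).1)
      (by simpa only [Real.rpow_two, sq_abs] using H1.integrable_coord_sq hg)
      (fun n => by simpa only [Real.rpow_two, sq_abs] using (hmass (φ n)).2.le) hlim_ae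
    simp only [Real.rpow_two, sq_abs] at h
    have h2 := h.const_sub (μ - ∫ q, G.coord g q ^ 2 ∂G.vol)
    rw [sub_zero] at h2
    refine h2.congr fun n => ?_
    rw [(hmass (φ n)).2]
    simp only [coord, Pi.sub_apply]
    ring
  have hpotLim := tendsto_integral_brezisLieb (r := p) (by linarith) (B := M ^ (p - 2) * μ)
      (fun n => (H1.memLp_coord (hmass (φ n)).1).1) (H1.memLp_coord hg).1
      (fun n => (hfpot (φ n)).1) hgpot.1
      (fun n => (hfpot (φ n)).2.trans_eq (by rw [(hmass (φ n)).2])) hlim_ae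
  have henergy : Tendsto (fun n => G.energy p (f (φ n) - g)) atTop (𝓝 (L - G.energy p g)) := by
    have h := (hE'.sub (hkin.const_mul (1 / 2))).add
      ((hpotLim.add_const (∫ q, |G.coord g q| ^ p ∂G.vol)).const_mul (1 / p))
    have e1 : L - 1 / 2 * ∫ q, G.dcoord g q ^ 2 ∂G.vol
        + 1 / p * (0 + ∫ q, |G.coord g q| ^ p ∂G.vol) = L - G.energy p g := by
      rw [energy_eq]; ring
    refine (e1 ▸ h).congr fun n => ?_
    simp only [energy_eq, coord, Pi.sub_apply]
    ring
  have hgm0 : 0 ≤ ∫ q, G.coord g q ^ 2 ∂G.vol := integral_nonneg fun q => sq_nonneg _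
  have hgmμ : ∫ q, G.coord g q ^ 2 ∂G.vol ≤ μ := sub_nonneg.1
    (ge_of_tendsto' hmassLim fun n => integral_nonneg fun q => sq_nonneg _)
  have hgpos : 0 < ∫ q, G.coord g q ^ 2 ∂G.vol := by
    refine hgm0.lt_of_ne' fun hz => ?_
    have hg0 := H1.eq_zero_of_mass_eq_zero hG hg hl0 hl hz
    simp only [hg0] at hlim
    -- Thresholds: if |f| ≤ c a.e., the potential integral is at most c^(p-2) μ = κ, so the energy
    -- is at least -κ/p = L/2, while eventually it lies below L/2.
    set κ := -L / 2 * p with hκ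
    have hκ0 : 0 < κ := by rw [hκ]; have : 0 < -L / 2 := by linarith
                           positivity
    set c := (κ / μ) ^ (p - 2)⁻¹ with hc
    have hc0 : 0 < c := by positivity
    have hp20 : 0 < p - 2 := by linarith
    have hcp : c ^ (p - 2) * μ = κ := by
      rw [hc, ← Real.rpow_mul (by positivity), inv_mul_cancel₀ hp20.ne', Real.rpow_one]
      field_simp
    have hev := eventually_sq_lt_of_tendsto_zero (fun n => (hmass (φ n)).1) hA0
      (fun n => hM (φ n)) (fun n => hA (φ n)) s hlim (δ := c ^ 2) (by positivity)
    have hev2 := hE'.eventually_lt_const (by linarith : L < L / 2)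
    obtain ⟨n, hn1, hn2⟩ := (hev.and hev2).exists
    obtain ⟨e, he, x, hx⟩ := hmax (φ n)
    have hy := abs_lt_of_sq_lt_sq (hn1 e he x) hc0.le
    have hmaxc : max (f (φ n) (G.pt e x)) 0 ≤ c := max_le ((le_abs_self _).trans hy.le) hc0.le
    have hpot := (H1.integrable_abs_rpow_and_le (hmass (φ n)).1 hp2
      (ae_abs_coord_le_of_eLpNorm_top hx)).2
    rw [(hmass (φ n)).2] at hpot
    have hpot2 : ∫ q, |G.coord (f (φ n)) q| ^ p ∂G.vol ≤ κ := by
      refine hpot.trans (hcp ▸ mul_le_mul_of_nonneg_right ?_ hμ.le)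
      exact Real.rpow_le_rpow (le_max_right _ _) hmaxc hp20.le
    have hkin0 : 0 ≤ ∫ q, G.dcoord (f (φ n)) q ^ 2 ∂G.vol := integral_nonneg fun q => sq_nonneg _
    rw [energy_eq] at hn2
    have h3 := mul_le_mul_of_nonneg_left hpot2 (by positivity : 0 ≤ 1 / p)
    have h4 : 1 / p * κ = -L / 2 := by rw [hκ]; field_simp
    linarith
  rcases hgmμ.lt_or_eq with hlt | heq
  · exfalso
    -- Dichotomy: the strict bound for g and the limiting bound for f_n - g add up to L < L.
    have h1 := lt_energy_of_mass_lt hL hp2 hg hgpot.1 hgpos hlt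
    have h2 : (μ - ∫ q, G.coord g q ^ 2 ∂G.vol) / μ * L ≤ L - G.energy p g := by
      refine le_of_tendsto_of_tendsto ((hmassLim.div_const μ).mul_const L) henergy ?_
      filter_upwards [hmassLim.eventually_lt_const (sub_lt_self μ hgpos)] with n hn
      exact le_energy_of_mass_le hL hp2 hμ (hsubH n) (hspot n).1 hn.le
    rw [sub_div, div_self hμ.ne', sub_mul, one_mul] at h2
    linarith
  · have hgmem : g ∈ G.H1Mass μ := ⟨hg, heq⟩
    rw [heq, sub_self] at hmassLim
    have hspotLim : Tendsto (fun n => ∫ q, |G.coord (f (φ n) - g) q| ^ p ∂G.vol) atTop (𝓝 0) :=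
      squeeze_zero (fun n => integral_nonneg fun q => by positivity) (fun n => (hspot n).2)
        (by simpa using hmassLim.const_mul ((M + M) ^ (p - 2)))
    have hkinLim : Tendsto (fun n => ∫ q, G.dcoord (f (φ n) - g) q ^ 2 ∂G.vol) atTop
        (𝓝 (2 * (L - G.energy p g))) := by
      have h := (henergy.add (hspotLim.const_mul (1 / p))).const_mul 2
      rw [mul_zero, add_zero] at h
      refine h.congr fun n => ?_
      rw [energy_eq]; ring
    -- The kinetic limit 2(L - E(g)) is nonnegative and L ≤ E(g), so both are equalities.
    have hge := le_energy_of_level_eq hL hgmem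
    have hle := ge_of_tendsto' hkinLim fun n => integral_nonneg fun q => sq_nonneg _
    have hEg : G.energy p g = L := by linarith
    refine ⟨g, ⟨hgmem, by rw [hEg, hL]⟩, φ, hφ, ?_⟩
    rw [hEg, sub_self, mul_zero] at hkinLim
    have h := (ENNReal.tendsto_ofReal (hmassLim.add hkinLim)).ennrpow_const (1 / 2 : ℝ)
    rw [add_zero, ENNReal.ofReal_zero, ENNReal.zero_rpow_of_pos (by norm_num)] at h
    exact h.congr fun n => (H1.h1Norm_eq (hsubH n)).symm

end MetricGraph

/-! ### Periodic graphs -/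

theorem Relation.EqvGen.exists_rel_of_ne {α : Type*} {r : α → α → Prop} {a b : α}
    (h : Relation.EqvGen r a b) : a = b ∨ ((∃ c, r a c ∨ r c a) ∧ ∃ c, r b c ∨ r c b) := by
  induction h with
  | rel x y h => exact Or.inr ⟨⟨y, Or.inl h⟩, ⟨x, Or.inr h⟩⟩
  | refl x => exact Or.inl rfl
  | symm x y _ ih => exact ih.imp Eq.symm And.symm
  | trans x y z _ _ ih1 ih2 =>
    rcases ih1 with rfl | h1
    · exact ih2
    · rcases ih2 with rfl | h2
      · exact Or.inr h1
      · exact Or.inr ⟨h1.1, h2.2⟩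

namespace PastingRule

variable {K : CompactGraph.{u, v}}

/-- Donors and receivers are nonempty and disjoint, so K has at least two vertices, and
connectedness puts an edge at each of them. -/
theorem exists_incident_edge (P : PastingRule K) (a : K.V) : ∃ e, K.src e = a ∨ K.tgt e = a := by
  obtain ⟨b, hb⟩ : ∃ b, a ≠ b := by
    obtain ⟨d, hd⟩ := P.nonempty_D
    obtain ⟨r, hr⟩ := P.nonempty_R
    by_cases had : a = d
    · exact ⟨r, fun h => P.not_mem_both (had ▸ hd) (h ▸ hr)⟩
    · exact ⟨d, had⟩
  obtain ⟨c, ⟨e, he, -⟩ | ⟨e, -, he⟩⟩ := ((K.connected a b).exists_rel_of_ne.resolve_left hb).1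
  · exact ⟨e, Or.inl he⟩
  · exact ⟨e, Or.inr he⟩

theorem exists_incident_edge_graph (P : PastingRule K) (a : P.graph.V) :
    ∃ e, P.graph.src e = a ∨ P.graph.tgt e = a := by
  induction a using Quotient.inductionOn with
  | h x =>
    obtain ⟨i, b⟩ := x
    obtain ⟨e, rfl | rfl⟩ := P.exists_incident_edge b
    · exact ⟨(i, e), Or.inl rfl⟩
    · exact ⟨(i, e), Or.inr rfl⟩

theorem exists_eq_pt_of_mem_cell (P : PastingRule K) {i : ℤ} {q : P.graph.Point}
    (hq : q ∈ P.cell i) : ∃ (e : K.E) (x : ℝ), q = P.graph.pt (i, e) x := by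
  rcases hq with ⟨a, rfl⟩ | h
  · obtain ⟨e, rfl | rfl⟩ := P.exists_incident_edge a
    · exact ⟨e, 0, (MetricGraph.pt_zero (G := P.graph) (i, e)).symm⟩
    · exact ⟨e, _, (MetricGraph.pt_len (G := P.graph) (i, e)).symm⟩
  · exact h

end PastingRule

theorem proposition3p1 {K : CompactGraph.{u, v}} (P : PastingRule K) (p μ : ℝ)
    (hp2 : 2 < p) (hp6 : p < 6) (hμ : 0 < μ)
    (hneg : P.graph.level p μ < 0)
    (f : ℕ → P.graph.Point → ℝ) (hf : P.graph.IsMinimizingSeq p μ f)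
    (hmax : ∀ n, ∃ x ∈ P.cell 0,
      eLpNorm (P.graph.coord (f n)) ∞ P.graph.vol = ENNReal.ofReal (f n x)) :
    ∃ g : P.graph.Point → ℝ, P.graph.IsGroundState p μ g ∧
      ∃ φ : ℕ → ℕ, StrictMono φ ∧
        Tendsto (fun n => P.graph.h1Norm (f (φ n) - g)) atTop (𝓝 0) := by
  have := K.finite_E
  have : Countable P.graph.E := inferInstanceAs (Countable (ℤ × K.E))
  obtain ⟨d, -⟩ := P.nonempty_D
  have : Nonempty K.E := ⟨(P.exists_incident_edge d).choose⟩
  -- The shortest edge of the cell bounds all edge lengths of the periodic graph from below.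
  obtain ⟨e₀, he₀⟩ := Finite.exists_min K.len
  refine MetricGraph.exists_isGroundState_of_isMinimizingSeq P.exists_incident_edge_graph
    (K.len_pos e₀) (fun e => he₀ e.2) hp2 hp6 hμ hneg hf
    (Set.toFinite (Set.range fun e : K.E => ((0, e) : ℤ × K.E))).toFinset fun n => ?_
  obtain ⟨q, hq, hn⟩ := hmax n
  obtain ⟨e, x, rfl⟩ := P.exists_eq_pt_of_mem_cell hq
  exact ⟨(0, e), (Set.Finite.mem_toFinset _).2 ⟨e, rfl⟩, x, hn⟩
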